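/- Let $(M,\omega)$ be a (Hausdorff, second countable) symplectic manifold of dimension $2N$, $A=C^\infty(M,\mathbb R)$, $E=\Gamma(TM)$ the $A$-module of smooth vector fields, $E^*=\mathrm{Hom}_A(E,A)$, $\wedge E^*$ the exterior algebra of the $A$-module $E^*$ (the algebra of differential forms), and $u:E\to E^*$, $u(x)y=\omega(x,y)$. Let $\mathcal D\subset TM$ be a polarization (an involutive lagrangian distribution), $\mathcal D'$ a lagrangian distribution transversal to $\mathcal D$, and $L,L'\subset E$ the submodules of vector fields tangent to $\mathcal D$ and $\mathcal D'$, so that $E=L\oplus L'$. Let $B$ be $A[\lambda]$ or $A[[\lambda]]$ (more generally, any commutative $A$-algebra with a distinguished element $\lambda$). Extend scalars in $E,E^*,\omega,u,L,L'$ from $A$ to $B$, keeping the same letters; all tensor products below, and the tensor algebra $T(E)$, symmetric algebra $S(E)$ and exterior algebra $\wedge E^*$, are taken over $B$. Let $W(E)=T(E)/\mathcal I_W$ be the Weyl algebra, where $\mathcal I_W$ is the two-sided ideal generated by the elements $x\otimes y-y\otimes x-\lambda\,\omega(x,y)$, and let $\mu_S:T(E)\to S(E)$, $\mu_W:T(E)\to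 W(E)$ be the canonical homomorphisms, with multiplications $\odot$ and $\circ$ in $S(E)$ and $W(E)$. The Koszul differential on $T(E)\otimes\wedge E^*$ is $$\delta(x_1\otimes\dots\otimes x_m\otimes y)=\sum_{i=1}^m x_1\otimes\dots\otimes\hat x_i\otimes\dots\otimes x_m\otimes u(x_i)\wedge y .$$ Then: 1. $\delta^2=0$, and $\delta$ descends to (necessarily unique) $B$-linear maps $\delta$ on $S(E)\otimes\wedge E^*$ and on $W(E)\otimes\wedge E^*$, commuting with $\mu_S\otimes\mathrm{Id}$ and $\mu_W\otimes\mathrm{Id}$. 2. There is exactly one $B$-linear map $\pi:S(E)\to W(E)$ with $$\pi(x'_1\odot\dots\odot x'_p\odot x_1\odot\dots\odot x_q)=x'_1\circ\dots\circ x'_p\circ x_1\circ\dots\circ x_q\qquad(x'_i\in L',\ x_j\in L,\ p,q\ge 0);$$ it is an isomorphism of $B$-modules, and $(\pi\otimes\mathrm{Id})\,\delta=\delta\,(\pi\otimes\mathrm{Id})$ on $S(E)\otimes\wedge E^*$. 3. $u:E\to E^*$ is an isomorphism, and there is a $B$-linear map $\delta^{-1}$ on $S(E)\otimes\wedge E^*$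 with $$\delta^{-1}(x_1\odot\dots\odot x_m\otimes y_1\wedge\dots\wedge y_n)=\frac1{m+n}\sum_{i=1}^n(-1)^{i-1}u^{-1}(y_i)\odot x_1\odot\dots\odot x_m\otimes y_1\wedge\dots\wedge\hat y_i\wedge\dots\wedge y_n$$ for $m+n>0$ and $\delta^{-1}(1\otimes 1)=0$. If $\tau$ is the projection of $S(E)\otimes\wedge E^*$ onto its component of bidegree $(0,0)$, then $\delta\delta^{-1}+\delta^{-1}\delta+\tau=\mathrm{Id}$ on $S(E)\otimes\wedge E^*$, and the same identity holds on $W(E)\otimes\wedge E^*$ for the maps $\delta^{-1},\tau$ transported there by the isomorphism $\pi\otimes\mathrm{Id}$. 4. $\delta$ maps $W(E)\otimes\wedge^nE^*$ to $W(E)\otimes\wedge^{n+1}E^*$ and $\delta^2=0$ there; the cohomology of the complex $\delta W^\bullet=(W(E)\otimes\wedge^\bullet E^*,\delta)$ is $H^0(\delta W^\bullet)=B$, via $c\mapsto[c\otimes1]$, and $H^n(\delta W^\bullet)=0$ for $n>0$. -/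

import Mathlib

open scoped TensorProduct Manifold ContDiff Topology

noncomputable section

/-! ### Weyl algebra and Koszul differential over a commutative ring -/

section Algebraic

/-- The defining relations `x ⊗ y - y ⊗ x - l Ω(x, y) = 0` of the Weyl algebra. -/
inductive WeylRel {R P : Type*} [CommRing R] [AddCommGroup P] [Module R P]
    (Ω : LinearMap.BilinForm R P) (l : R) : TensorAlgebra R P → TensorAlgebra R P → Prop
  | comm (x y : P) : WeylRel Ω l
      (TensorAlgebra.ι R x * TensorAlgebra.ι R y - TensorAlgebra.ι R y * TensorAlgebra.ι R x
        - algebraMap R (TensorAlgebra R P) (l * Ω x y)) 0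

/-- The Weyl algebra `W(P) = T(P) / I_W`, where `I_W` is the two-sided ideal generated by the
elements `x ⊗ y - y ⊗ x - l Ω(x, y)`. -/
abbrev WeylAlgebra {R P : Type*} [CommRing R] [AddCommGroup P] [Module R P]
    (Ω : LinearMap.BilinForm R P) (l : R) : Type _ :=
  RingQuot (WeylRel Ω l)

/-- The canonical homomorphism `μ_W : T(P) → W(P)`. -/
abbrev weylMk {R P : Type*} [CommRing R] [AddCommGroup P] [Module R P]
    (Ω : LinearMap.BilinForm R P) (l : R) : TensorAlgebra R P →ₐ[R] WeylAlgebra Ω l :=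
  RingQuot.mkAlgHom R (WeylRel Ω l)

/-- The canonical map `P → W(P)`. -/
def weylι {R P : Type*} [CommRing R] [AddCommGroup P] [Module R P]
    (Ω : LinearMap.BilinForm R P) (l : R) : P →ₗ[R] WeylAlgebra Ω l :=
  (weylMk Ω l).toLinearMap ∘ₗ TensorAlgebra.ι R

/-- `x ∈ P` acts on pairs `(a, b)` of elements of `T(P) ⊗ ∧Q` by
`(a, b) ↦ (x a, x b + u(x) ∧ a)`; extended multiplicatively to `T(P)`. -/
def koszulAux {R P Q : Type*} [CommRing R] [AddCommGroup P] [Module R P]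
    [AddCommGroup Q] [Module R Q] (u : P →ₗ[R] Q) :
    TensorAlgebra R P →ₐ[R]
      Module.End R ((TensorAlgebra R P ⊗[R] ExteriorAlgebra R Q) ×
        (TensorAlgebra R P ⊗[R] ExteriorAlgebra R Q)) :=
  TensorAlgebra.lift R
    { toFun := fun x =>
        LinearMap.prodMap (LinearMap.mulLeft R (TensorAlgebra.ι R x ⊗ₜ[R] 1))
            (LinearMap.mulLeft R (TensorAlgebra.ι R x ⊗ₜ[R] 1))
          + LinearMap.inr R _ _ ∘ₗ
              LinearMap.mulLeft R (1 ⊗ₜ[R] ExteriorAlgebra.ι R (u x)) ∘ₗ LinearMap.fst R _ _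
      map_add' := by
        intro x y
        ext <;> simp [TensorProduct.add_tmul, TensorProduct.tmul_add, add_mul]
      map_smul' := by
        intro c x
        ext <;> simp [TensorProduct.smul_tmul'] }

/-- The Koszul differential on `T(P) ⊗ ∧Q` attached to `u : P → Q`,
`δ(x₁ ⊗ ⋯ ⊗ xₘ ⊗ y) = ∑ᵢ x₁ ⊗ ⋯ ⊗ x̂ᵢ ⊗ ⋯ ⊗ xₘ ⊗ u(xᵢ) ∧ y`; see `koszul_apply`. -/
def koszul {R P Q : Type*} [CommRing R] [AddCommGroup P] [Module R P]
    [AddCommGroup Q] [Module R Q] (u : P →ₗ[R] Q) :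
    TensorAlgebra R P ⊗[R] ExteriorAlgebra R Q →ₗ[R]
      TensorAlgebra R P ⊗[R] ExteriorAlgebra R Q :=
  TensorProduct.lift
    (LinearMap.mk₂ R (fun t y => (koszulAux u t (1 ⊗ₜ[R] y, 0)).2)
      (by intro t t' y; simp)
      (by intro c t y; simp)
      (by
        intro t y y'
        rw [TensorProduct.tmul_add, ← add_zero (0 : TensorAlgebra R P ⊗[R] ExteriorAlgebra R Q),
          ← Prod.mk_add_mk, map_add, add_zero]
        rfl)
      (by
        intro c t y
        have h : ((1 : TensorAlgebra R P) ⊗ₜ[R] (c • y),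
            (0 : TensorAlgebra R P ⊗[R] ExteriorAlgebra R Q)) = c • (1 ⊗ₜ[R] y, 0) := by simp
        rw [h, map_smul]
        rfl))

theorem koszulAux_fst {R P Q : Type*} [CommRing R] [AddCommGroup P] [Module R P]
    [AddCommGroup Q] [Module R Q] (u : P →ₗ[R] Q) (xs : List P) (y : ExteriorAlgebra R Q) :
    (koszulAux u (xs.map (TensorAlgebra.ι R)).prod (1 ⊗ₜ[R] y, 0)).1
      = (xs.map (TensorAlgebra.ι R)).prod ⊗ₜ[R] y := by
  induction xs with
  | nil => simp
  | cons x xs ih =>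
    rw [List.map_cons, List.prod_cons, map_mul, Module.End.mul_apply]
    conv_lhs => rw [koszulAux, TensorAlgebra.lift_ι_apply]
    rw [← koszulAux]
    simp [ih]

/-- The explicit formula for the Koszul differential. -/
theorem koszul_apply {R P Q : Type*} [CommRing R] [AddCommGroup P] [Module R P]
    [AddCommGroup Q] [Module R Q] (u : P →ₗ[R] Q) (xs : List P) (y : ExteriorAlgebra R Q) :
    koszul u ((xs.map (TensorAlgebra.ι R)).prod ⊗ₜ[R] y)
      = ∑ i : Fin xs.length, ((xs.eraseIdx i).map (TensorAlgebra.ι R)).prod ⊗ₜ[R]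
          (ExteriorAlgebra.ι R (u xs[i]) * y) := by
  induction xs with
  | nil => simp [koszul]
  | cons x xs ih =>
    have h1 := koszulAux_fst u xs y
    simp only [koszul, TensorProduct.lift.tmul, LinearMap.mk₂_apply] at ih ⊢
    rw [List.map_cons, List.prod_cons, map_mul, Module.End.mul_apply]
    conv_lhs => rw [koszulAux, TensorAlgebra.lift_ι_apply]
    rw [← koszulAux]
    simp only [LinearMap.coe_mk, AddHom.coe_mk, LinearMap.add_apply, LinearMap.prodMap_apply,
      LinearMap.comp_apply, LinearMap.fst_apply, LinearMap.inr_apply, Prod.snd_add,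
      LinearMap.mulLeft_apply, h1, ih]
    rw [add_comm]
    simp [Fin.sum_univ_succ, Finset.mul_sum]

/-- The projection `τ` of `S(P) ⊗ ∧Q` onto its component of bidegree `(0, 0)`. -/
def bidegreeZero (R P Q : Type*) [CommRing R] [AddCommGroup P] [Module R P]
    [AddCommGroup Q] [Module R Q] :
    SymmetricAlgebra R P ⊗[R] ExteriorAlgebra R Q →ₗ[R]
      SymmetricAlgebra R P ⊗[R] ExteriorAlgebra R Q :=
  TensorProduct.map
    (Algebra.linearMap R _ ∘ₗ (SymmetricAlgebra.algebraMapInv (R := R) (M := P)).toLinearMap)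
    (Algebra.linearMap R _ ∘ₗ (ExteriorAlgebra.algebraMapInv (R := R) (M := Q)).toLinearMap)

/-- The submodule `X ⊗ ∧ⁿQ` of `X ⊗ ∧Q`. -/
def formDegree (R X Q : Type*) [CommRing R] [AddCommGroup X] [Module R X]
    [AddCommGroup Q] [Module R Q] (n : ℕ) : Submodule R (X ⊗[R] ExteriorAlgebra R Q) :=
  LinearMap.range (LinearMap.lTensor X (⋀[R]^n Q).subtype)

/-- The `n`-cocycles of a differential `d` of degree one on `X ⊗ ∧Q`. -/
def cocycles (R X Q : Type*) [CommRing R] [AddCommGroup X] [Module R X]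
    [AddCommGroup Q] [Module R Q]
    (d : X ⊗[R] ExteriorAlgebra R Q →ₗ[R] X ⊗[R] ExteriorAlgebra R Q) (n : ℕ) :
    Submodule R (X ⊗[R] ExteriorAlgebra R Q) :=
  formDegree R X Q n ⊓ LinearMap.ker d

/-- The `n`-coboundaries: `0` for `n = 0` and `d (X ⊗ ∧ⁿ⁻¹Q)` for `n > 0`. -/
def coboundaries (R X Q : Type*) [CommRing R] [AddCommGroup X] [Module R X]
    [AddCommGroup Q] [Module R Q]
    (d : X ⊗[R] ExteriorAlgebra R Q →ₗ[R] X ⊗[R] ExteriorAlgebra R Q) :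
    ℕ → Submodule R (X ⊗[R] ExteriorAlgebra R Q)
  | 0 => ⊥
  | n + 1 => (formDegree R X Q n).map d

/-- The `n`-th cohomology module of the complex `X ⊗ ∧⁰Q → X ⊗ ∧¹Q → ⋯` with differential `d`. -/
abbrev Cohomology (R X Q : Type*) [CommRing R] [AddCommGroup X] [Module R X]
    [AddCommGroup Q] [Module R Q]
    (d : X ⊗[R] ExteriorAlgebra R Q →ₗ[R] X ⊗[R] ExteriorAlgebra R Q) (n : ℕ) : Type _ :=
  cocycles R X Q d n ⧸ (coboundaries R X Q d n).comap (cocycles R X Q d n).subtype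

/-- The cohomology class of a cocycle. -/
def cohomologyClass {R X Q : Type*} [CommRing R] [AddCommGroup X] [Module R X]
    [AddCommGroup Q] [Module R Q]
    {d : X ⊗[R] ExteriorAlgebra R Q →ₗ[R] X ⊗[R] ExteriorAlgebra R Q} {n : ℕ}
    (z : cocycles R X Q d n) : Cohomology R X Q d n :=
  Submodule.Quotient.mk z

/-- `π : S(P) → W(P)` is the normal ordering map of the decomposition `P = L ⊕ L'`: it sends the
product in `S(P)` of elements of `L'` followed by elements of `L` to their product in `W(P)` in
the same order. -/
def IsNormalOrdering {R P : Type*} [CommRing R] [AddCommGroup P] [Module R P]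
    (Ω : LinearMap.BilinForm R P) (l : R) (L L' : Submodule R P)
    (π : SymmetricAlgebra R P →ₗ[R] WeylAlgebra Ω l) : Prop :=
  ∀ xs' xs : List P, (∀ x ∈ xs', x ∈ L') → (∀ x ∈ xs, x ∈ L) →
    π ((xs'.map (SymmetricAlgebra.ι R P)).prod * (xs.map (SymmetricAlgebra.ι R P)).prod)
      = (xs'.map (weylι Ω l)).prod * (xs.map (weylι Ω l)).prod

/-- `h` is the contracting homotopy `δ⁻¹` on `S(P) ⊗ ∧Q` attached to the isomorphism `u : P → Q`:
`h(x₁ ⋯ xₘ ⊗ y₁ ∧ ⋯ ∧ yₙ) = (m + n)⁻¹ ∑ᵢ (-1)ⁱ⁻¹ u⁻¹(yᵢ) x₁ ⋯ xₘ ⊗ y₁ ∧ ⋯ ∧ ŷᵢ ∧ ⋯ ∧ yₙ`,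
and `h(1 ⊗ 1) = 0` (the sum is then empty). The real scalars act on `R`-modules through `ρ`. -/
def IsContractingHomotopy {R P Q : Type*} [CommRing R] [AddCommGroup P] [Module R P]
    [AddCommGroup Q] [Module R Q] (ρ : ℝ →+* R) (u : P ≃ₗ[R] Q)
    (h : SymmetricAlgebra R P ⊗[R] ExteriorAlgebra R Q →ₗ[R]
      SymmetricAlgebra R P ⊗[R] ExteriorAlgebra R Q) : Prop :=
  ∀ (xs : List P) (ys : List Q),
    h ((xs.map (SymmetricAlgebra.ι R P)).prod ⊗ₜ[R] (ys.map (ExteriorAlgebra.ι R)).prod)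
      = ρ ((xs.length + ys.length : ℝ)⁻¹) •
        ∑ i : Fin ys.length, (-1 : R) ^ (i : ℕ) •
          ((SymmetricAlgebra.ι R P (u.symm ys[i]) * (xs.map (SymmetricAlgebra.ι R P)).prod)
            ⊗ₜ[R] ((ys.eraseIdx i).map (ExteriorAlgebra.ι R)).prod)

/-- The assertions about the Koszul complexes of `S(P)` and `W(P)`, for `u : P → Q`, a bilinear
form `Ω` on `P`, an element `l` and a decomposition `P = L ⊕ L'`. -/
structure KoszulTransport {R P Q : Type*} [CommRing R] [AddCommGroup P] [Module R P]
    [AddCommGroup Q] [Module R Q] (ρ : ℝ →+* R) (Ω : LinearMap.BilinForm R P) (l : R)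
    (u : P →ₗ[R] Q) (L L' : Submodule R P)
    (δS : SymmetricAlgebra R P ⊗[R] ExteriorAlgebra R Q →ₗ[R]
      SymmetricAlgebra R P ⊗[R] ExteriorAlgebra R Q)
    (δW : WeylAlgebra Ω l ⊗[R] ExteriorAlgebra R Q →ₗ[R]
      WeylAlgebra Ω l ⊗[R] ExteriorAlgebra R Q)
    (π : SymmetricAlgebra R P ≃ₗ[R] WeylAlgebra Ω l)
    (e : P ≃ₗ[R] Q)
    (h : SymmetricAlgebra R P ⊗[R] ExteriorAlgebra R Q →ₗ[R]
      SymmetricAlgebra R P ⊗[R] ExteriorAlgebra R Q) : Prop where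
  /-- `δ` is a differential on `T(P) ⊗ ∧Q`. -/
  koszul_sq : koszul u ∘ₗ koszul u = 0
  /-- `δ` descends along `μ_S ⊗ Id : T(P) ⊗ ∧Q → S(P) ⊗ ∧Q`. -/
  descends_S : δS ∘ₗ (SymmetricAlgebra.algHom R P).toLinearMap.rTensor (ExteriorAlgebra R Q)
    = (SymmetricAlgebra.algHom R P).toLinearMap.rTensor (ExteriorAlgebra R Q) ∘ₗ koszul u
  /-- `δ` descends along `μ_W ⊗ Id : T(P) ⊗ ∧Q → W(P) ⊗ ∧Q`. -/
  descends_W : δW ∘ₗ (weylMk Ω l).toLinearMap.rTensor (ExteriorAlgebra R Q)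
    = (weylMk Ω l).toLinearMap.rTensor (ExteriorAlgebra R Q) ∘ₗ koszul u
  /-- `π` is the normal ordering isomorphism. -/
  normalOrdering : IsNormalOrdering Ω l L L' π.toLinearMap
  /-- `π` is the only normal ordering map. -/
  normalOrdering_unique : ∀ π' : SymmetricAlgebra R P →ₗ[R] WeylAlgebra Ω l,
    IsNormalOrdering Ω l L L' π' → π' = π.toLinearMap
  /-- `δ` commutes with `π ⊗ Id`. -/
  commutes : π.toLinearMap.rTensor (ExteriorAlgebra R Q) ∘ₗ δS
    = δW ∘ₗ π.toLinearMap.rTensor (ExteriorAlgebra R Q)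
  /-- `u` is an isomorphism. -/
  iso : e.toLinearMap = u
  /-- `h` is the contracting homotopy on `S(P) ⊗ ∧Q`. -/
  homotopy : IsContractingHomotopy ρ e h
  /-- `δ δ⁻¹ + δ⁻¹ δ + τ = Id` on `S(P) ⊗ ∧Q`. -/
  homotopy_S : δS ∘ₗ h + h ∘ₗ δS + bidegreeZero R P Q = LinearMap.id
  /-- `δ δ⁻¹ + δ⁻¹ δ + τ = Id` on `W(P) ⊗ ∧Q`, for the maps transported by `π ⊗ Id`. -/
  homotopy_W : δW ∘ₗ (π.rTensor (ExteriorAlgebra R Q)).conj h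
      + (π.rTensor (ExteriorAlgebra R Q)).conj h ∘ₗ δW
      + (π.rTensor (ExteriorAlgebra R Q)).conj (bidegreeZero R P Q) = LinearMap.id
  /-- `δ` is a differential on `W(P) ⊗ ∧Q`. -/
  sq_W : δW ∘ₗ δW = 0
  /-- `δ` maps `W(P) ⊗ ∧ⁿQ` into `W(P) ⊗ ∧ⁿ⁺¹Q`. -/
  degree_W : ∀ n, (formDegree R (WeylAlgebra Ω l) Q n).map δW
    ≤ formDegree R (WeylAlgebra Ω l) Q (n + 1)
  /-- `H⁰ = R`: the map `R → H⁰`, `c ↦ [c ⊗ 1]`, is well defined and an isomorphism. -/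
  cohomology_zero : ∃ f : R ≃ₗ[R] Cohomology R (WeylAlgebra Ω l) Q δW 0,
    ∀ c : R, ∃ z : cocycles R (WeylAlgebra Ω l) Q δW 0,
      (z : WeylAlgebra Ω l ⊗[R] ExteriorAlgebra R Q) = c • (1 ⊗ₜ[R] 1) ∧
        f c = cohomologyClass z
  /-- `Hⁿ = 0` for `n > 0`. -/
  cohomology_pos : ∀ n, 0 < n → Subsingleton (Cohomology R (WeylAlgebra Ω l) Q δW n)

end Algebraic

/-! ### Symplectic manifolds and polarizations -/

section Geometric

/-- `A = C^∞(M, ℝ)` for a manifold of dimension `2N`. -/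
abbrev SmoothFun (N : ℕ) (M : Type*) [TopologicalSpace M]
    [ChartedSpace (EuclideanSpace ℝ (Fin (2 * N))) M] : Type _ :=
  C^∞⟮𝓡 (2 * N), M; 𝓘(ℝ, ℝ), ℝ⟯

/-- `E = Γ(TM)`, the smooth vector fields on `M`. -/
abbrev VecField (N : ℕ) (M : Type*) [TopologicalSpace M]
    [ChartedSpace (EuclideanSpace ℝ (Fin (2 * N))) M] [IsManifold (𝓡 (2 * N)) ∞ M] : Type _ :=
  Cₛ^∞⟮𝓡 (2 * N); EuclideanSpace ℝ (Fin (2 * N)),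
    fun p : M => TangentSpace (𝓡 (2 * N)) p⟯

/-- Pointwise multiplication of vector fields by smooth functions. -/
instance VecField.instSMulFun (N : ℕ) (M : Type*) [TopologicalSpace M]
    [ChartedSpace (EuclideanSpace ℝ (Fin (2 * N))) M] [IsManifold (𝓡 (2 * N)) ∞ M] :
    SMul (SmoothFun N M) (VecField N M) where
  smul f X := ⟨fun p => f p • X p, f.contMDiff.smul_section X.contMDiff⟩

@[simp]
theorem VecField.fun_smul_apply {N : ℕ} {M : Type*} [TopologicalSpace M]
    [ChartedSpace (EuclideanSpace ℝ (Fin (2 * N))) M] [IsManifold (𝓡 (2 * N)) ∞ M]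
    (f : SmoothFun N M) (X : VecField N M) (p : M) : (f • X) p = f p • X p := rfl

/-- The vector fields form a module over the smooth functions. -/
instance VecField.instModuleFun (N : ℕ) (M : Type*) [TopologicalSpace M]
    [ChartedSpace (EuclideanSpace ℝ (Fin (2 * N))) M] [IsManifold (𝓡 (2 * N)) ∞ M] :
    Module (SmoothFun N M) (VecField N M) where
  one_smul X := by ext p : 1; simp
  mul_smul f g X := by ext p : 1; simp [mul_smul]
  smul_zero f := by ext p : 1; simp
  smul_add f X Y := by ext p : 1; simp
  add_smul f g X := by ext p : 1; simp [add_smul]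
  zero_smul X := by ext p : 1; simp

/-- The derivative `X f` of a function along a vector field. -/
def lieDeriv {N : ℕ} {M : Type*} [TopologicalSpace M]
    [ChartedSpace (EuclideanSpace ℝ (Fin (2 * N))) M] [IsManifold (𝓡 (2 * N)) ∞ M]
    (X : VecField N M) (f : M → ℝ) (p : M) : ℝ :=
  mfderiv (𝓡 (2 * N)) 𝓘(ℝ, ℝ) f p (X p)

/-- The vecBracket `[X, Y]` of vector fields. -/
def vecBracket {N : ℕ} {M : Type*} [TopologicalSpace M]
    [ChartedSpace (EuclideanSpace ℝ (Fin (2 * N))) M] [IsManifold (𝓡 (2 * N)) ∞ M]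
    (X Y : VecField N M) (p : M) : TangentSpace (𝓡 (2 * N)) p :=
  VectorField.mlieBracket (𝓡 (2 * N)) (fun q => X q) (fun q => Y q) p

/-- A symplectic form on `M`: a smooth, alternating, nondegenerate and closed 2-form. -/
structure SymplecticForm (N : ℕ) (M : Type*) [TopologicalSpace M]
    [ChartedSpace (EuclideanSpace ℝ (Fin (2 * N))) M] [IsManifold (𝓡 (2 * N)) ∞ M] where
  form : ∀ p : M, TangentSpace (𝓡 (2 * N)) p →ₗ[ℝ] TangentSpace (𝓡 (2 * N)) p →ₗ[ℝ] ℝ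
  smooth : ∀ X Y : VecField N M,
    ContMDiff (𝓡 (2 * N)) 𝓘(ℝ, ℝ) ∞ (fun p => form p (X p) (Y p))
  alternating : ∀ p v, form p v v = 0
  nondegenerate : ∀ p v, (∀ w, form p v w = 0) → v = 0
  closed : ∀ (X Y Z : VecField N M) (p : M),
    lieDeriv X (fun q => form q (Y q) (Z q)) p
      - lieDeriv Y (fun q => form q (X q) (Z q)) p
      + lieDeriv Z (fun q => form q (X q) (Y q)) p
      - form p (vecBracket X Y p) (Z p)
      + form p (vecBracket X Z p) (Y p)
      - form p (vecBracket Y Z p) (X p) = 0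

/-- `Ω` as an `A`-bilinear form on `E`. -/
def SymplecticForm.bilin {N : ℕ} {M : Type*} [TopologicalSpace M]
    [ChartedSpace (EuclideanSpace ℝ (Fin (2 * N))) M] [IsManifold (𝓡 (2 * N)) ∞ M]
    (Ω : SymplecticForm N M) : LinearMap.BilinForm (SmoothFun N M) (VecField N M) :=
  LinearMap.mk₂ (SmoothFun N M)
    (fun X Y => (⟨fun p => Ω.form p (X p) (Y p), Ω.smooth X Y⟩ : SmoothFun N M))
    (by intro X X' Y; ext p; simp; rfl)
    (by intro f X Y; ext p; simp; rfl)
    (by intro X Y Y'; ext p; simp; rfl)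
    (by intro f X Y; ext p; simp; rfl)

/-- The map `u : E → E*`, `u(x) y = Ω(x, y)`. -/
def SymplecticForm.flat {N : ℕ} {M : Type*} [TopologicalSpace M]
    [ChartedSpace (EuclideanSpace ℝ (Fin (2 * N))) M] [IsManifold (𝓡 (2 * N)) ∞ M]
    (Ω : SymplecticForm N M) :
    VecField N M →ₗ[SmoothFun N M] Module.Dual (SmoothFun N M) (VecField N M) :=
  Ω.bilin

/-- A lagrangian distribution: a smooth distribution of rank `N` on which `Ω` vanishes. -/
structure LagrangianDistribution {N : ℕ} {M : Type*} [TopologicalSpace M]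
    [ChartedSpace (EuclideanSpace ℝ (Fin (2 * N))) M] [IsManifold (𝓡 (2 * N)) ∞ M]
    (Ω : SymplecticForm N M) where
  space : ∀ p : M, Submodule ℝ (TangentSpace (𝓡 (2 * N)) p)
  /-- Near every point the distribution has a frame of `N` smooth vector fields. -/
  smooth : ∀ p : M, ∃ X : Fin N → VecField N M, ∀ᶠ q in 𝓝 p,
    LinearIndependent ℝ (fun i => X i q) ∧ Submodule.span ℝ (Set.range fun i => X i q) = space q
  isotropic : ∀ p, ∀ v ∈ space p, ∀ w ∈ space p, Ω.form p v w = 0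

/-- The module of vector fields tangent to a distribution. -/
def LagrangianDistribution.sections {N : ℕ} {M : Type*} [TopologicalSpace M]
    [ChartedSpace (EuclideanSpace ℝ (Fin (2 * N))) M] [IsManifold (𝓡 (2 * N)) ∞ M]
    {Ω : SymplecticForm N M} (D : LagrangianDistribution Ω) :
    Submodule (SmoothFun N M) (VecField N M) where
  carrier := {X | ∀ p, X p ∈ D.space p}
  add_mem' hX hY p := (D.space p).add_mem (hX p) (hY p)
  zero_mem' p := (D.space p).zero_mem
  smul_mem' f _ hX p := (D.space p).smul_mem (f p) (hX p)

/-- A polarization: a lagrangian distribution that is involutive. -/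
structure Polarization {N : ℕ} {M : Type*} [TopologicalSpace M]
    [ChartedSpace (EuclideanSpace ℝ (Fin (2 * N))) M] [IsManifold (𝓡 (2 * N)) ∞ M]
    (Ω : SymplecticForm N M) extends LagrangianDistribution Ω where
  involutive : ∀ X ∈ toLagrangianDistribution.sections,
    ∀ Y ∈ toLagrangianDistribution.sections, ∀ p, vecBracket X Y p ∈ space p

end Geometric

end

/-!
The theorem has an algebraic part, valid over any commutative ring `R` with a ring homomorphism
`ℝ → R`, and a geometric part which provides its hypotheses.

*Koszul differentials.* On `A ⊗ ∧Q`, for a quotient `A` of `T(P)`, the Koszul differential is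
determined by `δ(1 ⊗ y) = 0` and by its commutator with the multiplication by `x ∈ P`, which is the
multiplication by `1 ⊗ u(x)` (`IsKoszul`). It exists on `S(P)` and on `W(P)` because
`x ↦ x ⊗ 1 + ε (1 ⊗ u(x))` respects the defining relations in the dual numbers over `A ⊗ ∧Q`; the
commutator formula gives `δ² = 0` and the compatibility with the projections.

*The homotopy.* If `k` contracts the exterior factors into `S(P)` by `u⁻¹`, the commutators of
`δ` and `k` with the multiplications show that `δ k + k δ` is the multiplication by the total degree
`m + n` (`koszul_contraction_symExtMonomial`). As `δ` preserves the total degree, dividing by it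
gives `δ⁻¹` and the homotopy formula (`symHomotopy_add`).

*Normal ordering.* The decomposition `P = L ⊕ L'` gives a comultiplication `S(P) → S(P) ⊗ S(P)`;
followed by the multiplication of `W(P)` it is the normal ordering map `π`. Conversely `W(P)` acts
on `S(P)`: an element `x` of `L'` acts as the multiplication by `x`, an element of `L` as this
multiplication plus `l` times the derivation extending `Ω(x, ·)` on `L'` and `0` on `L`. Evaluation
at `1` is the inverse of `π`. The derivations commute with `δ`, hence `π` intertwines the two
differentials (`IsNormalOrdering.exists_inverse`), the homotopy formula is transported to `W(P)`,
and the cohomology follows (`exists_koszulTransport`).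

*Geometry.* Near a point, Cramer's rule for the pairing matrix of frames of the two distributions,
multiplied by a bump function, expresses `g Z` for every vector field `Z` as a combination of fields
tangent to the distributions with coefficients `Ω(Z, f)`, where `g` is a function not vanishing at
the point (`exists_local_dual_frame`). Hence the pointwise projections and the pointwise inverse of
`u` preserve smoothness, so that `E = L ⊕ L'` and `u` is an isomorphism over `C^∞(M)`; both
survive the extension of scalars.
-/

noncomputable section

/-! ### Koszul differentials on quotients of the tensor algebra -/

section KoszulDescent

variable {R P Q : Type*} [CommRing R] [AddCommGroup P] [Module R P] [AddCommGroup Q] [Module R Q]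

/-- The lift of a linear map with pairwise commuting values in an algebra, not necessarily
commutative, to the symmetric algebra. -/
def SymmetricAlgebra.liftOfCommute {A : Type*} [Ring A] [Algebra R A] (f : P →ₗ[R] A)
    (hf : ∀ x y, f x * f y = f y * f x) : SymmetricAlgebra R P →ₐ[R] A :=
  RingCon.liftₐ (TensorAlgebra.symRingCon R P) (TensorAlgebra.lift R f) (by
    refine RingCon.ringConGen_le.2 ?_
    rintro _ _ ⟨x, y⟩
    rw [RingCon.ker_apply]
    simp [hf x y])

theorem SymmetricAlgebra.liftOfCommute_ι {A : Type*} [Ring A] [Algebra R A] (f : P →ₗ[R] A)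
    (hf : ∀ x y, f x * f y = f y * f x) (x : P) :
    liftOfCommute f hf (ι R P x) = f x :=
  TensorAlgebra.lift_ι_apply f x

/-- A subset of a quotient of the tensor algebra which contains `1` and is stable under linear
combinations and under left multiplication by generators is everything. -/
theorem TensorAlgebra.induction_left {A : Type*} [Ring A] [Algebra R A]
    {q : TensorAlgebra R P →ₐ[R] A} (hq : Function.Surjective q) {p : A → Prop}
    (one : p 1) (add : ∀ a b, p a → p b → p (a + b)) (smul : ∀ (c : R) a, p a → p (c • a))
    (mul : ∀ x a, p a → p (q (TensorAlgebra.ι R x) * a)) (a : A) : p a := by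
  obtain ⟨t, rfl⟩ := hq a
  suffices h : ∀ b, p b → p (q t * b) by simpa using h 1 one
  induction t using TensorAlgebra.induction with
  | algebraMap r => intro b hb; simpa [← Algebra.smul_def] using smul r b hb
  | ι x => exact mul x
  | mul s t hs ht => intro b hb; rw [map_mul, mul_assoc]; exact hs _ (ht _ hb)
  | add s t hs ht => intro b hb; rw [map_add, add_mul]; exact add _ _ (hs _ hb) (ht _ hb)

/-- `δ` is the Koszul differential on `A ⊗ ∧Q`, for a quotient `q : T(P) → A` of the tensor
algebra. It is determined by its commutator with the left multiplication by a generator. -/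
structure IsKoszul {A : Type*} [Ring A] [Algebra R A] (u : P →ₗ[R] Q)
    (q : TensorAlgebra R P →ₐ[R] A)
    (δ : A ⊗[R] ExteriorAlgebra R Q →ₗ[R] A ⊗[R] ExteriorAlgebra R Q) : Prop where
  surjective : Function.Surjective q
  one_tmul : ∀ y, δ (1 ⊗ₜ y) = 0
  ι_mul : ∀ x m, δ ((q (TensorAlgebra.ι R x) ⊗ₜ 1) * m)
    = (q (TensorAlgebra.ι R x) ⊗ₜ 1) * δ m + (1 ⊗ₜ ExteriorAlgebra.ι R (u x)) * m

theorem tmul_mem_formDegree {A : Type*} [AddCommGroup A] [Module R A] (a : A)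
    {y : ExteriorAlgebra R Q} {n : ℕ} (hy : y ∈ ⋀[R]^n Q) : a ⊗ₜ y ∈ formDegree R A Q n :=
  ⟨a ⊗ₜ ⟨y, hy⟩, rfl⟩

theorem tmul_one_mul_mem_formDegree {A : Type*} [Ring A] [Algebra R A] (a : A) {n : ℕ}
    {m : A ⊗[R] ExteriorAlgebra R Q} (hm : m ∈ formDegree R A Q n) :
    (a ⊗ₜ 1) * m ∈ formDegree R A Q n := by
  obtain ⟨m, rfl⟩ := hm
  induction m using TensorProduct.induction_on with
  | zero => simp
  | add m m' h h' => simpa only [map_add, mul_add] using Submodule.add_mem _ h h'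
  | tmul b y => exact ⟨(a * b) ⊗ₜ y, by simp⟩

namespace IsKoszul

variable {A A' : Type*} [Ring A] [Algebra R A] [Ring A'] [Algebra R A'] {u : P →ₗ[R] Q}
  {q : TensorAlgebra R P →ₐ[R] A} {q' : TensorAlgebra R P →ₐ[R] A'}
  {δ : A ⊗[R] ExteriorAlgebra R Q →ₗ[R] A ⊗[R] ExteriorAlgebra R Q}
  {δ' : A' ⊗[R] ExteriorAlgebra R Q →ₗ[R] A' ⊗[R] ExteriorAlgebra R Q}

theorem ι_mul_tmul (hδ : IsKoszul u q δ) (x : P) (a : A) (y : ExteriorAlgebra R Q) :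
    δ ((q (TensorAlgebra.ι R x) * a) ⊗ₜ y) = (q (TensorAlgebra.ι R x) ⊗ₜ 1) * δ (a ⊗ₜ y)
      + a ⊗ₜ (ExteriorAlgebra.ι R (u x) * y) := by
  simpa using hδ.ι_mul x (a ⊗ₜ y)

/-- A Koszul differential anticommutes with the exterior multiplications, which act on the right
of the factor `u(xᵢ)`. -/
theorem ι_wedge (hδ : IsKoszul u q δ) (z : Q) (m : A ⊗[R] ExteriorAlgebra R Q) :
    δ ((1 ⊗ₜ ExteriorAlgebra.ι R z) * m) = -((1 ⊗ₜ ExteriorAlgebra.ι R z) * δ m) := by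
  induction m using TensorProduct.induction_on with
  | zero => simp
  | add m m' h h' => rw [mul_add, map_add, h, h', map_add, mul_add, neg_add]
  | tmul a y =>
    simp only [Algebra.TensorProduct.tmul_mul_tmul, one_mul]
    induction a using TensorAlgebra.induction_left hδ.surjective with
    | one => simp [hδ.one_tmul]
    | add a b ha hb => simp only [TensorProduct.add_tmul, map_add, ha, hb, mul_add, neg_add]
    | smul c a ha => simp only [← TensorProduct.smul_tmul', map_smul, ha, mul_smul_comm, smul_neg]
    | mul x a ha =>
      have h := eq_neg_of_add_eq_zero_left (ExteriorAlgebra.ι_add_mul_swap (R := R) z (u x))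
      simp only [hδ.ι_mul_tmul, ha, mul_add, neg_add, mul_neg, ← mul_assoc,
        Algebra.TensorProduct.tmul_mul_tmul, one_mul, mul_one, h, neg_mul, TensorProduct.tmul_neg,
        neg_neg]

theorem comp_self (hδ : IsKoszul u q δ) : δ ∘ₗ δ = 0 := by
  refine TensorProduct.ext' fun a y => ?_
  simp only [LinearMap.comp_apply, LinearMap.zero_apply]
  induction a using TensorAlgebra.induction_left hδ.surjective with
  | one => simp [hδ.one_tmul]
  | add a b ha hb => simp only [TensorProduct.add_tmul, map_add, ha, hb, add_zero]
  | smul c a ha => simp only [← TensorProduct.smul_tmul', map_smul, ha, smul_zero]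
  | mul x a ha =>
    have h := hδ.ι_wedge (u x) (a ⊗ₜ y)
    simp only [Algebra.TensorProduct.tmul_mul_tmul, one_mul] at h
    rw [hδ.ι_mul_tmul, map_add, hδ.ι_mul, ha, mul_zero, zero_add, h, add_neg_cancel]

/-- Any algebra homomorphism between quotients of the tensor algebra which is compatible with the
projections commutes with the Koszul differentials. -/
theorem comp_rTensor (hδ : IsKoszul u q δ) (hδ' : IsKoszul u q' δ') (f : A →ₐ[R] A')
    (hf : f.comp q = q') :
    δ' ∘ₗ f.toLinearMap.rTensor (ExteriorAlgebra R Q)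
      = f.toLinearMap.rTensor (ExteriorAlgebra R Q) ∘ₗ δ := by
  have hfm : ∀ a m, f.toLinearMap.rTensor (ExteriorAlgebra R Q) ((a ⊗ₜ 1) * m)
      = (f a ⊗ₜ 1) * f.toLinearMap.rTensor (ExteriorAlgebra R Q) m := by
    intro a m
    induction m using TensorProduct.induction_on with
    | zero => simp
    | add m m' h h' => rw [mul_add, map_add, h, h', map_add, mul_add]
    | tmul b y => simp
  refine TensorProduct.ext' fun a y => ?_
  simp only [LinearMap.comp_apply]
  induction a using TensorAlgebra.induction_left hδ.surjective with
  | one => simp [hδ.one_tmul, hδ'.one_tmul]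
  | add a b ha hb => simp only [TensorProduct.add_tmul, map_add, ha, hb]
  | smul c a ha => simp only [← TensorProduct.smul_tmul', map_smul, ha]
  | mul x a ha =>
    have hx : f (q (TensorAlgebra.ι R x)) = q' (TensorAlgebra.ι R x) := by rw [← hf]; rfl
    rw [hδ.ι_mul_tmul, map_add, hfm, ← ha]
    simp [hx, hδ'.ι_mul_tmul]

theorem map_formDegree_le (hδ : IsKoszul u q δ) (n : ℕ) :
    (formDegree R A Q n).map δ ≤ formDegree R A Q (n + 1) := by
  rintro _ ⟨_, ⟨m, rfl⟩, rfl⟩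
  induction m using TensorProduct.induction_on with
  | zero => simp
  | add m m' h h' => simpa only [map_add] using Submodule.add_mem _ h h'
  | tmul a y =>
    rw [LinearMap.lTensor_tmul, Submodule.subtype_apply]
    induction a using TensorAlgebra.induction_left hδ.surjective with
    | one => simp [hδ.one_tmul]
    | add a b ha hb =>
      simpa only [TensorProduct.add_tmul, map_add] using Submodule.add_mem _ ha hb
    | smul c a ha =>
      simpa only [← TensorProduct.smul_tmul', map_smul] using Submodule.smul_mem _ c ha
    | mul x a ha =>
      rw [hδ.ι_mul_tmul]
      refine Submodule.add_mem _ (tmul_one_mul_mem_formDegree _ ha) (tmul_mem_formDegree _ ?_)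
      rw [ExteriorAlgebra.exteriorPower, pow_succ']
      exact Submodule.mul_mem_mul ⟨_, rfl⟩ y.2

/-- The linear map `x ↦ x ⊗ 1 + ε (1 ⊗ u(x))` from `P` to the dual numbers over `A ⊗ ∧Q`. -/
def dualGenerator (u : P →ₗ[R] Q) (q : TensorAlgebra R P →ₐ[R] A) :
    P →ₗ[R] DualNumber (A ⊗[R] ExteriorAlgebra R Q) where
  toFun x := (q (TensorAlgebra.ι R x) ⊗ₜ 1, 1 ⊗ₜ ExteriorAlgebra.ι R (u x))
  map_add' x y := by
    simp only [map_add, TensorProduct.add_tmul, TensorProduct.tmul_add]; rfl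
  map_smul' c x := by
    simp only [map_smul, TensorProduct.tmul_smul, TensorProduct.smul_tmul']; rfl

theorem fst_dualGenerator (x : P) :
    (dualGenerator u q x).fst = q (TensorAlgebra.ι R x) ⊗ₜ 1 := rfl

theorem snd_dualGenerator (x : P) :
    (dualGenerator u q x).snd = 1 ⊗ₜ ExteriorAlgebra.ι R (u x) := rfl

theorem dualGenerator_mul_sub (x y : P) :
    dualGenerator u q x * dualGenerator u q y - dualGenerator u q y * dualGenerator u q x
      = TrivSqZeroExt.inl ((q (TensorAlgebra.ι R x * TensorAlgebra.ι R y
          - TensorAlgebra.ι R y * TensorAlgebra.ι R x)) ⊗ₜ 1) := by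
  ext
  · simp [fst_dualGenerator, TensorProduct.sub_tmul]
  · simp [fst_dualGenerator, snd_dualGenerator, add_comm]

/-- The Koszul differential attached to an algebra homomorphism `θ : A → (A ⊗ ∧Q)[ε]` with
`θ(x) = x ⊗ 1 + ε (1 ⊗ u(x))` on generators: `δ(a ⊗ y)` is the product of the coefficient of `ε`
in `θ(a)` and of `1 ⊗ y`. -/
theorem exists_of_dualNumber (hq : Function.Surjective q)
    (θ : A →ₐ[R] DualNumber (A ⊗[R] ExteriorAlgebra R Q))
    (hθ : ∀ x, θ (q (TensorAlgebra.ι R x)) = dualGenerator u q x) : ∃ δ, IsKoszul u q δ := by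
  let d : A →ₗ[R] A ⊗[R] ExteriorAlgebra R Q :=
    { toFun := fun a => (θ a).snd
      map_add' := by simp
      map_smul' := by simp }
  let δ : A ⊗[R] ExteriorAlgebra R Q →ₗ[R] A ⊗[R] ExteriorAlgebra R Q :=
    TensorProduct.lift ((LinearMap.mul R (A ⊗[R] ExteriorAlgebra R Q)).compl₁₂ d
      (Algebra.TensorProduct.includeRight (R := R) (A := A)
        (B := ExteriorAlgebra R Q)).toLinearMap)
  have h1 : ∀ a y, δ (a ⊗ₜ y) = (θ a).snd * (1 ⊗ₜ y) := fun a y => rfl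
  refine ⟨δ, hq, fun y => by simp [h1], fun x m => ?_⟩
  induction m using TensorProduct.induction_on with
  | zero => simp
  | add m m' h h' => rw [mul_add, map_add, h, h', map_add, mul_add, mul_add]; abel
  | tmul a y =>
    have hfst : (θ a).fst = a ⊗ₜ 1 := by
      induction a using TensorAlgebra.induction_left hq with
      | one => simp [Algebra.TensorProduct.one_def]
      | add a b ha hb => simp [ha, hb, TensorProduct.add_tmul]
      | smul c a ha => simp [ha, TensorProduct.smul_tmul']
      | mul x a ha => simp [ha, hθ, fst_dualGenerator]
    simp [h1, hθ, hfst, fst_dualGenerator, snd_dualGenerator, mul_assoc, add_mul]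

end IsKoszul

theorem isKoszul_koszul (u : P →ₗ[R] Q) :
    IsKoszul u (AlgHom.id R (TensorAlgebra R P)) (koszul u) where
  surjective := Function.surjective_id
  one_tmul y := by simpa using koszul_apply u [] y
  ι_mul x m := by
    have hfst : ∀ t y, (koszulAux u t (1 ⊗ₜ[R] y, 0)).1 = t ⊗ₜ[R] y := by
      intro t y
      induction t using TensorAlgebra.induction_left (q := AlgHom.id R (TensorAlgebra R P))
        Function.surjective_id with
      | one => simp
      | add a b ha hb => simp [ha, hb, TensorProduct.add_tmul]
      | smul c a ha => simp [ha, TensorProduct.smul_tmul']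
      | mul x a ha =>
        rw [AlgHom.id_apply, map_mul, Module.End.mul_apply]
        conv_lhs => rw [koszulAux, TensorAlgebra.lift_ι_apply]
        rw [← koszulAux]
        simp [ha]
    induction m using TensorProduct.induction_on with
    | zero => simp
    | add m m' h h' => rw [mul_add, map_add, h, h', map_add, mul_add, mul_add]; abel
    | tmul a y =>
      have h1 := hfst a y
      simp only [koszul, Algebra.TensorProduct.tmul_mul_tmul, TensorProduct.lift.tmul,
        LinearMap.mk₂_apply, AlgHom.id_apply, one_mul] at h1 ⊢
      rw [map_mul, Module.End.mul_apply]
      conv_lhs => rw [koszulAux, TensorAlgebra.lift_ι_apply]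
      rw [← koszulAux]
      simp [h1]

theorem exists_isKoszul_symmetricAlgebra (u : P →ₗ[R] Q) :
    ∃ δ, IsKoszul u (SymmetricAlgebra.algHom R P) δ := by
  refine IsKoszul.exists_of_dualNumber (SymmetricAlgebra.algHom_surjective R P)
    (SymmetricAlgebra.liftOfCommute
      (IsKoszul.dualGenerator u (SymmetricAlgebra.algHom R P)) fun x y => ?_)
    fun x => SymmetricAlgebra.liftOfCommute_ι _ _ x
  rw [← sub_eq_zero, IsKoszul.dualGenerator_mul_sub, map_sub, map_mul, map_mul,
    mul_comm, sub_self, TensorProduct.zero_tmul, TrivSqZeroExt.inl_zero]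

theorem weylι_apply (Ω : LinearMap.BilinForm R P) (l : R) (x : P) :
    weylMk Ω l (TensorAlgebra.ι R x) = weylι Ω l x := rfl

theorem weylMk_surjective (Ω : LinearMap.BilinForm R P) (l : R) :
    Function.Surjective (weylMk Ω l) := RingQuot.mkAlgHom_surjective _ _

theorem weylι_mul_sub (Ω : LinearMap.BilinForm R P) (l : R) (x y : P) :
    weylι Ω l x * weylι Ω l y - weylι Ω l y * weylι Ω l x = algebraMap R _ (l * Ω x y) := by
  have h := RingQuot.mkAlgHom_rel R (WeylRel.comm (Ω := Ω) (l := l) x y)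
  rw [map_sub, map_zero, sub_eq_zero, AlgHom.commutes, map_sub, map_mul, map_mul] at h
  exact h

/-- The universal property of the Weyl algebra. -/
def weylLift (Ω : LinearMap.BilinForm R P) (l : R) {A : Type*} [Ring A] [Algebra R A]
    (f : P →ₗ[R] A) (hf : ∀ x y, f x * f y - f y * f x = algebraMap R A (l * Ω x y)) :
    WeylAlgebra Ω l →ₐ[R] A :=
  RingQuot.liftAlgHom R ⟨TensorAlgebra.lift R f, by
    rintro _ _ ⟨x, y⟩
    simp only [map_sub, map_mul, TensorAlgebra.lift_ι_apply, AlgHom.commutes, map_zero]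
    rw [hf, map_mul, sub_self]⟩

theorem weylLift_ι (Ω : LinearMap.BilinForm R P) (l : R) {A : Type*} [Ring A] [Algebra R A]
    (f : P →ₗ[R] A) (hf : ∀ x y, f x * f y - f y * f x = algebraMap R A (l * Ω x y)) (x : P) :
    weylLift Ω l f hf (weylι Ω l x) = f x := by
  rw [← weylι_apply, weylLift, RingQuot.liftAlgHom_mkAlgHom_apply, TensorAlgebra.lift_ι_apply]

theorem exists_isKoszul_weylAlgebra (u : P →ₗ[R] Q) (Ω : LinearMap.BilinForm R P) (l : R) :
    ∃ δ, IsKoszul u (weylMk Ω l) δ := by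
  refine IsKoszul.exists_of_dualNumber (weylMk_surjective Ω l)
    (weylLift Ω l (IsKoszul.dualGenerator u (weylMk Ω l)) fun x y => ?_)
    fun x => weylLift_ι Ω l _ _ x
  rw [IsKoszul.dualGenerator_mul_sub, map_sub, map_mul, map_mul, weylι_apply, weylι_apply,
    weylι_mul_sub]
  rfl

end KoszulDescent

/-! ### The contracting homotopy on `S(P) ⊗ ∧Q` -/

section Homotopy

variable {R P Q : Type*} [CommRing R] [AddCommGroup P] [Module R P] [AddCommGroup Q] [Module R Q]

/-- A quotient of the tensor algebra is spanned by the products of generators. -/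
theorem TensorAlgebra.span_list_prod {A : Type*} [Ring A] [Algebra R A]
    {q : TensorAlgebra R P →ₐ[R] A} (hq : Function.Surjective q) (a : A) :
    a ∈ Submodule.span R
      (Set.range fun xs : List P => (xs.map fun x => q (TensorAlgebra.ι R x)).prod) := by
  induction a using TensorAlgebra.induction_left hq with
  | one => exact Submodule.subset_span ⟨[], rfl⟩
  | add a b ha hb => exact Submodule.add_mem _ ha hb
  | smul c a ha => exact Submodule.smul_mem _ c ha
  | mul x a ha =>
    induction ha using Submodule.span_induction with
    | mem a ha =>
      obtain ⟨xs, rfl⟩ := ha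
      exact Submodule.subset_span ⟨x :: xs, by simp⟩
    | zero => simp
    | add a b _ _ ha hb => rw [mul_add]; exact Submodule.add_mem _ ha hb
    | smul c a _ ha => rw [mul_smul_comm]; exact Submodule.smul_mem _ c ha

theorem TensorAlgebra.toExterior_surjective :
    Function.Surjective (TensorAlgebra.toExterior (R := R) (M := Q)) := by
  intro y
  induction y using ExteriorAlgebra.induction with
  | algebraMap r => exact ⟨algebraMap R _ r, by simp⟩
  | ι z => exact ⟨TensorAlgebra.ι R z, by simp⟩
  | mul y z hy hz =>
    obtain ⟨s, rfl⟩ := hy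
    obtain ⟨t, rfl⟩ := hz
    exact ⟨s * t, map_mul _ _ _⟩
  | add y z hy hz =>
    obtain ⟨s, rfl⟩ := hy
    obtain ⟨t, rfl⟩ := hz
    exact ⟨s + t, map_add _ _ _⟩

/-- The monomial `x₁ ⋯ xₘ ⊗ y₁ ∧ ⋯ ∧ yₙ` in `S(P) ⊗ ∧Q`. -/
def symExtMonomial (R : Type*) [CommRing R] [Module R P] [Module R Q] (xs : List P) (ys : List Q) :
    SymmetricAlgebra R P ⊗[R] ExteriorAlgebra R Q :=
  (xs.map (SymmetricAlgebra.ι R P)).prod ⊗ₜ[R] (ys.map (ExteriorAlgebra.ι R)).prod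

theorem symExtMonomial_cons_left (x : P) (xs : List P) (ys : List Q) :
    symExtMonomial R (x :: xs) ys
      = (SymmetricAlgebra.ι R P x ⊗ₜ 1) * symExtMonomial R xs ys := by
  simp [symExtMonomial]

theorem symExtMonomial_cons_right (y : Q) (ys : List Q) :
    symExtMonomial R ([] : List P) (y :: ys)
      = (1 ⊗ₜ ExteriorAlgebra.ι R y) * symExtMonomial R [] ys := by
  simp [symExtMonomial]

theorem symExtMonomial_nil :
    symExtMonomial R ([] : List P) ([] : List Q) = 1 := by
  simp [symExtMonomial, Algebra.TensorProduct.one_def]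

theorem symExt_hom_ext {X : Type*} [AddCommGroup X] [Module R X]
    {f g : SymmetricAlgebra R P ⊗[R] ExteriorAlgebra R Q →ₗ[R] X}
    (h : ∀ xs ys, f (symExtMonomial R xs ys) = g (symExtMonomial R xs ys)) : f = g := by
  refine TensorProduct.ext' fun s y => ?_
  have hs := TensorAlgebra.span_list_prod (SymmetricAlgebra.algHom_surjective R P) s
  have hy := TensorAlgebra.span_list_prod (R := R) (P := Q) TensorAlgebra.toExterior_surjective y
  induction hs using Submodule.span_induction with
  | zero => simp
  | add a b _ _ ha hb => simp only [TensorProduct.add_tmul, map_add, ha, hb]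
  | smul c a _ ha => simp only [← TensorProduct.smul_tmul', map_smul, ha]
  | mem a ha =>
    obtain ⟨xs, rfl⟩ := ha
    induction hy using Submodule.span_induction with
    | zero => simp
    | add a b _ _ ha hb => simp only [TensorProduct.tmul_add, map_add, ha, hb]
    | smul c a _ ha => simp only [TensorProduct.tmul_smul, map_smul, ha]
    | mem a ha =>
      obtain ⟨ys, rfl⟩ := ha
      have h' := h xs ys
      rw [symExtMonomial] at h'
      convert h' using 3 <;> simp <;> rfl

variable {A : Type*} [CommRing A] [Algebra R A]

/-- The algebra homomorphism from `∧Q` to the `2 × 2` matrices over `A ⊗ ∧Q` with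
`q ↦ (1 ⊗ q, 0; v(q) ⊗ 1, -(1 ⊗ q))`. Its lower left entry is the antiderivation extending `v`. -/
def contractionMatrix (v : Q →ₗ[R] A) : ExteriorAlgebra R Q →ₐ[R]
    Matrix (Fin 2) (Fin 2) (A ⊗[R] ExteriorAlgebra R Q) :=
  ExteriorAlgebra.lift R
    ⟨{ toFun := fun z => !![1 ⊗ₜ ExteriorAlgebra.ι R z, 0;
          v z ⊗ₜ 1, -(1 ⊗ₜ ExteriorAlgebra.ι R z)]
       map_add' := fun z z' => by
        ext i j; fin_cases i <;> fin_cases j <;>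
          simp [TensorProduct.tmul_add, TensorProduct.add_tmul, add_comm]
       map_smul' := fun c z => by
        ext i j; fin_cases i <;> fin_cases j <;> simp [TensorProduct.smul_tmul'] },
     fun z => by
      ext i j; fin_cases i <;> fin_cases j <;> simp [Matrix.mul_apply]⟩

theorem contractionMatrix_ι (v : Q →ₗ[R] A) (z : Q) :
    contractionMatrix v (ExteriorAlgebra.ι R z) = !![1 ⊗ₜ ExteriorAlgebra.ι R z, 0;
      v z ⊗ₜ 1, -(1 ⊗ₜ ExteriorAlgebra.ι R z)] := by
  rw [contractionMatrix, ExteriorAlgebra.lift_ι_apply]; rfl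

theorem contractionMatrix_zero_zero (v : Q →ₗ[R] A) (y : ExteriorAlgebra R Q) :
    contractionMatrix v y 0 0 = 1 ⊗ₜ y := by
  induction y using TensorAlgebra.induction_left TensorAlgebra.toExterior_surjective with
  | one => simp [Algebra.TensorProduct.one_def]
  | add a b ha hb => simp [ha, hb, TensorProduct.tmul_add]
  | smul c a ha => simp [ha]
  | mul x a ha => simp [Matrix.mul_apply, contractionMatrix_ι, ha]

/-- The unnormalized homotopy
`s ⊗ y₁ ∧ ⋯ ∧ yₙ ↦ ∑ᵢ (-1)ⁱ⁻¹ v(yᵢ) s ⊗ y₁ ∧ ⋯ ∧ ŷᵢ ∧ ⋯ ∧ yₙ` on `A ⊗ ∧Q`. -/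
def contraction (v : Q →ₗ[R] A) :
    A ⊗[R] ExteriorAlgebra R Q →ₗ[R] A ⊗[R] ExteriorAlgebra R Q :=
  TensorProduct.lift ((LinearMap.mul R (A ⊗[R] ExteriorAlgebra R Q)).compl₁₂
    (Algebra.TensorProduct.includeLeft (R := R) (S := R) (A := A)
      (B := ExteriorAlgebra R Q)).toLinearMap
    (Matrix.entryLinearMap R _ 1 0 ∘ₗ (contractionMatrix v).toLinearMap))

theorem contraction_tmul (v : Q →ₗ[R] A) (s : A)
    (y : ExteriorAlgebra R Q) :
    contraction v (s ⊗ₜ y) = (s ⊗ₜ 1) * contractionMatrix v y 1 0 := rfl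

theorem contraction_mul_left (v : Q →ₗ[R] A) (s : A)
    (m : A ⊗[R] ExteriorAlgebra R Q) :
    contraction v ((s ⊗ₜ 1) * m) = (s ⊗ₜ 1) * contraction v m := by
  induction m using TensorProduct.induction_on with
  | zero => simp
  | add m m' h h' => rw [mul_add, map_add, h, h', map_add, mul_add]
  | tmul a y => simp [contraction_tmul, ← mul_assoc]

theorem contraction_wedge (v : Q →ₗ[R] A) (z : Q)
    (m : A ⊗[R] ExteriorAlgebra R Q) :
    contraction v ((1 ⊗ₜ ExteriorAlgebra.ι R z) * m)
      = (v z ⊗ₜ 1) * m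
        - (1 ⊗ₜ ExteriorAlgebra.ι R z) * contraction v m := by
  induction m using TensorProduct.induction_on with
  | zero => simp
  | add m m' h h' => rw [mul_add, map_add, h, h', map_add, mul_add, mul_add]; abel
  | tmul a y =>
    simp only [Algebra.TensorProduct.tmul_mul_tmul, one_mul, contraction_tmul, map_mul,
      Matrix.mul_apply, Fin.sum_univ_two, contractionMatrix_ι, contractionMatrix_zero_zero]
    simp [mul_add, ← mul_assoc, mul_comm, sub_eq_add_neg]

theorem contraction_list (v : Q →ₗ[R] A) (s : A) (ys : List Q) :
    contraction v (s ⊗ₜ (ys.map (ExteriorAlgebra.ι R)).prod)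
      = ∑ i : Fin ys.length, (-1 : R) ^ (i : ℕ) •
          ((v ys[i] * s)
            ⊗ₜ[R] ((ys.eraseIdx i).map (ExteriorAlgebra.ι R)).prod) := by
  induction ys with
  | nil => simp [contraction_tmul]
  | cons y ys ih =>
    have h := contraction_wedge v y (s ⊗ₜ (ys.map (ExteriorAlgebra.ι R)).prod)
    simp only [Algebra.TensorProduct.tmul_mul_tmul, one_mul] at h
    rw [List.map_cons, List.prod_cons, h, ih]
    simp [Fin.sum_univ_succ, Finset.mul_sum, pow_succ, sub_eq_add_neg]

/-- On monomials, `δ k + k δ` is the multiplication by the total degree. -/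
theorem koszul_contraction_symExtMonomial {u : P →ₗ[R] Q} {v : Q →ₗ[R] P}
    (huv : ∀ z, u (v z) = z) (hvu : ∀ x, v (u x) = x)
    {δ : SymmetricAlgebra R P ⊗[R] ExteriorAlgebra R Q →ₗ[R]
      SymmetricAlgebra R P ⊗[R] ExteriorAlgebra R Q}
    (hδ : IsKoszul u (SymmetricAlgebra.algHom R P) δ) (xs : List P) (ys : List Q) :
    δ (contraction (SymmetricAlgebra.ι R P ∘ₗ v) (symExtMonomial R xs ys))
        + contraction (SymmetricAlgebra.ι R P ∘ₗ v) (δ (symExtMonomial R xs ys))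
      = (xs.length + ys.length) • symExtMonomial R xs ys := by
  have hX : ∀ x m, δ ((SymmetricAlgebra.ι R P x ⊗ₜ 1) * m)
    = (SymmetricAlgebra.ι R P x ⊗ₜ 1) * δ m + (1 ⊗ₜ ExteriorAlgebra.ι R (u x)) * m := hδ.ι_mul
  induction xs with
  | cons x xs ih =>
    simp only [symExtMonomial_cons_left, contraction_mul_left, hX, map_add,
      contraction_wedge, LinearMap.comp_apply, hvu, List.length_cons]
    rw [show xs.length + 1 + ys.length = (xs.length + ys.length) + 1 by ring, add_smul, one_smul,
      ← mul_smul_comm, ← ih, mul_add]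
    abel
  | nil =>
    induction ys with
    | nil => simp [symExtMonomial, hδ.one_tmul, contraction_tmul]
    | cons y ys ih =>
      simp only [symExtMonomial_cons_right, contraction_wedge, hδ.ι_wedge, LinearMap.comp_apply, hX,
        map_sub, map_neg, huv, List.length_cons, List.length_nil] at ih ⊢
      rw [← add_assoc, add_smul, one_smul, ← mul_smul_comm, ← ih, mul_add]
      abel

open Polynomial

/-- The map `c ↦ c X` from an algebra `C` to `C[X]`. -/
def monomialOne (R C : Type*) [CommRing R] [Ring C] [Algebra R C] : C →ₗ[R] C[X] :=
  LinearMap.restrictScalars R (monomial 1)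

theorem monomialOne_apply {C : Type*} [Ring C] [Algebra R C] (c : C) :
    monomialOne R C c = monomial 1 c := rfl

/-- The algebra homomorphism `S(P) ⊗ ∧Q → (S(P) ⊗ ∧Q)[X]` which multiplies the elements of total
degree `d` by `X ^ d`. -/
def totalDegreeHom (R P Q : Type*) [CommRing R] [AddCommGroup P] [Module R P] [AddCommGroup Q]
    [Module R Q] : SymmetricAlgebra R P ⊗[R] ExteriorAlgebra R Q →ₐ[R]
      (SymmetricAlgebra R P ⊗[R] ExteriorAlgebra R Q)[X] :=
  Algebra.TensorProduct.lift
    (SymmetricAlgebra.liftOfCommute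
      (monomialOne R _ ∘ₗ
        (Algebra.TensorProduct.includeLeft (R := R) (S := R)).toLinearMap ∘ₗ
          SymmetricAlgebra.ι R P)
      fun x y => by simp [monomialOne_apply, monomial_mul_monomial, mul_comm])
    (ExteriorAlgebra.lift R
      ⟨monomialOne R _ ∘ₗ
        (Algebra.TensorProduct.includeRight (R := R)).toLinearMap ∘ₗ ExteriorAlgebra.ι R,
        fun z => by simp [monomialOne_apply, monomial_mul_monomial]⟩)
    fun s y => by
      induction s using SymmetricAlgebra.induction with
      | algebraMap r => rw [AlgHom.commutes]; exact Algebra.commute_algebraMap_left r _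
      | mul a b ha hb => rw [map_mul]; exact ha.mul_left hb
      | add a b ha hb => rw [map_add]; exact ha.add_left hb
      | ι x =>
        induction y using ExteriorAlgebra.induction with
        | algebraMap r => rw [AlgHom.commutes]; exact Algebra.commute_algebraMap_right r _
        | mul a b ha hb => rw [map_mul]; exact ha.mul_right hb
        | add a b ha hb => rw [map_add]; exact ha.add_right hb
        | ι z => simp [SymmetricAlgebra.liftOfCommute_ι, commute_iff_eq,
            monomialOne_apply, monomial_mul_monomial]

theorem totalDegreeHom_ι_mul (x : P) {d : ℕ}
    {m : SymmetricAlgebra R P ⊗[R] ExteriorAlgebra R Q}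
    (hm : totalDegreeHom R P Q m = monomial d m) :
    totalDegreeHom R P Q ((SymmetricAlgebra.ι R P x ⊗ₜ 1) * m)
      = monomial (d + 1) ((SymmetricAlgebra.ι R P x ⊗ₜ 1) * m) := by
  rw [map_mul, hm, add_comm, ← monomial_mul_monomial]
  simp [totalDegreeHom, monomialOne_apply, SymmetricAlgebra.liftOfCommute_ι]

theorem totalDegreeHom_wedge (z : Q) {d : ℕ}
    {m : SymmetricAlgebra R P ⊗[R] ExteriorAlgebra R Q}
    (hm : totalDegreeHom R P Q m = monomial d m) :
    totalDegreeHom R P Q ((1 ⊗ₜ ExteriorAlgebra.ι R z) * m)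
      = monomial (d + 1) ((1 ⊗ₜ ExteriorAlgebra.ι R z) * m) := by
  rw [map_mul, hm, add_comm, ← monomial_mul_monomial]
  simp [totalDegreeHom, monomialOne_apply]

/-- A Koszul differential preserves the total degree. -/
theorem totalDegreeHom_symExtMonomial {u : P →ₗ[R] Q}
    {δ : SymmetricAlgebra R P ⊗[R] ExteriorAlgebra R Q →ₗ[R]
      SymmetricAlgebra R P ⊗[R] ExteriorAlgebra R Q}
    (hδ : IsKoszul u (SymmetricAlgebra.algHom R P) δ) (xs : List P) (ys : List Q) :
    totalDegreeHom R P Q (symExtMonomial R xs ys)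
        = monomial (xs.length + ys.length) (symExtMonomial R xs ys) ∧
      totalDegreeHom R P Q (δ (symExtMonomial R xs ys))
        = monomial (xs.length + ys.length) (δ (symExtMonomial R xs ys)) := by
  have hX : ∀ x m, δ ((SymmetricAlgebra.ι R P x ⊗ₜ 1) * m)
    = (SymmetricAlgebra.ι R P x ⊗ₜ 1) * δ m + (1 ⊗ₜ ExteriorAlgebra.ι R (u x)) * m := hδ.ι_mul
  induction xs with
  | cons x xs ih =>
    rw [symExtMonomial_cons_left, hX, map_add, map_add, totalDegreeHom_ι_mul x ih.1,
      totalDegreeHom_ι_mul x ih.2, totalDegreeHom_wedge (u x) ih.1, List.length_cons,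
      add_right_comm]
    exact ⟨rfl, rfl⟩
  | nil =>
    induction ys with
    | nil =>
      have h1 := hδ.one_tmul 1
      rw [← Algebra.TensorProduct.one_def] at h1
      simp [symExtMonomial_nil, h1]
    | cons y ys ih =>
      rw [symExtMonomial_cons_right, hδ.ι_wedge, map_neg, map_neg, totalDegreeHom_wedge y ih.1,
        totalDegreeHom_wedge y ih.2, List.length_cons, ← add_assoc]
      exact ⟨rfl, rfl⟩

/-- The linear map which divides the elements of total degree `d` by `d`, and kills those of
degree `0`. -/
def divTotalDegree (P Q : Type*) [AddCommGroup P] [Module R P] [AddCommGroup Q]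
    [Module R Q] (ρ : ℝ →+* R) : SymmetricAlgebra R P ⊗[R] ExteriorAlgebra R Q →ₗ[R]
      SymmetricAlgebra R P ⊗[R] ExteriorAlgebra R Q :=
  Polynomial.lsum (fun d : ℕ => ρ (d : ℝ)⁻¹ • LinearMap.id) ∘ₗ (totalDegreeHom R P Q).toLinearMap

theorem divTotalDegree_apply (ρ : ℝ →+* R) {d : ℕ}
    {m : SymmetricAlgebra R P ⊗[R] ExteriorAlgebra R Q}
    (hm : totalDegreeHom R P Q m = monomial d m) :
    divTotalDegree P Q ρ m = ρ (d : ℝ)⁻¹ • m := by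
  simp [divTotalDegree, hm, Polynomial.lsum_apply, Polynomial.sum_monomial_index]

/-- The contracting homotopy `δ⁻¹` on `S(P) ⊗ ∧Q`. -/
def symHomotopy (ρ : ℝ →+* R) (v : Q →ₗ[R] P) :
    SymmetricAlgebra R P ⊗[R] ExteriorAlgebra R Q →ₗ[R]
      SymmetricAlgebra R P ⊗[R] ExteriorAlgebra R Q :=
  contraction (SymmetricAlgebra.ι R P ∘ₗ v) ∘ₗ divTotalDegree P Q ρ

theorem isContractingHomotopy_symHomotopy (ρ : ℝ →+* R) (e : P ≃ₗ[R] Q) :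
    IsContractingHomotopy ρ e (symHomotopy ρ e.symm.toLinearMap) := by
  obtain ⟨δ, hδ⟩ := exists_isKoszul_symmetricAlgebra e.toLinearMap
  intro xs ys
  have h := divTotalDegree_apply ρ (totalDegreeHom_symExtMonomial hδ xs ys).1
  rw [symExtMonomial] at h
  rw [symHomotopy, LinearMap.comp_apply, h, map_smul, contraction_list]
  push_cast
  rfl

theorem bidegreeZero_symExtMonomial (xs : List P) (ys : List Q) (h : 0 < xs.length + ys.length) :
    bidegreeZero R P Q (symExtMonomial R xs ys) = 0 := by
  cases xs with
  | cons x xs => simp [bidegreeZero, symExtMonomial, SymmetricAlgebra.algebraMapInv_ι]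
  | nil => cases ys with
    | cons y ys => simp [bidegreeZero, symExtMonomial, ExteriorAlgebra.algebraMapInv]
    | nil => simp at h

theorem symHomotopy_add (ρ : ℝ →+* R) (e : P ≃ₗ[R] Q)
    {δ : SymmetricAlgebra R P ⊗[R] ExteriorAlgebra R Q →ₗ[R]
      SymmetricAlgebra R P ⊗[R] ExteriorAlgebra R Q}
    (hδ : IsKoszul e.toLinearMap (SymmetricAlgebra.algHom R P) δ) :
    δ ∘ₗ symHomotopy ρ e.symm.toLinearMap + symHomotopy ρ e.symm.toLinearMap ∘ₗ δ
      + bidegreeZero R P Q = LinearMap.id := by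
  refine symExt_hom_ext fun xs ys => ?_
  obtain ⟨h1, h2⟩ := totalDegreeHom_symExtMonomial hδ xs ys
  have h3 := koszul_contraction_symExtMonomial (v := e.symm.toLinearMap) (by simp) (by simp)
    hδ xs ys
  simp only [LinearMap.add_apply, LinearMap.comp_apply, symHomotopy, divTotalDegree_apply ρ h1,
    divTotalDegree_apply ρ h2, map_smul, LinearMap.id_apply]
  rw [← smul_add, h3]
  rcases Nat.eq_zero_or_pos (xs.length + ys.length) with h | h
  · obtain ⟨hx, hy⟩ := Nat.add_eq_zero_iff.mp h
    rw [List.eq_nil_of_length_eq_zero hx, List.eq_nil_of_length_eq_zero hy]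
    simp [bidegreeZero, symExtMonomial]
  · rw [bidegreeZero_symExtMonomial xs ys h, add_zero, ← Nat.cast_smul_eq_nsmul R, smul_smul,
      ← map_natCast ρ, ← map_mul, inv_mul_cancel₀ (by positivity), map_one, one_smul]

/-- The forms of degree `n` are spanned by the monomials with `n` factors in the exterior
algebra. -/
theorem map_mem_of_mem_formDegree {X : Type*} [AddCommGroup X] [Module R X]
    (f : SymmetricAlgebra R P ⊗[R] ExteriorAlgebra R Q →ₗ[R] X) (N : Submodule R X) {n : ℕ}
    (h : ∀ xs ys, ys.length = n → f (symExtMonomial R xs ys) ∈ N)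
    {m : SymmetricAlgebra R P ⊗[R] ExteriorAlgebra R Q}
    (hm : m ∈ formDegree R (SymmetricAlgebra R P) Q n) : f m ∈ N := by
  obtain ⟨m, rfl⟩ := hm
  induction m using TensorProduct.induction_on with
  | zero => simp
  | add m m' h h' => rw [map_add, map_add]; exact Submodule.add_mem _ h h'
  | tmul s y =>
    obtain ⟨y, hy⟩ := y
    rw [LinearMap.lTensor_tmul, Submodule.subtype_apply]
    have hs := TensorAlgebra.span_list_prod (SymmetricAlgebra.algHom_surjective R P) s
    dsimp only
    rw [← ExteriorAlgebra.ιMulti_span_fixedDegree] at hy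
    induction hs using Submodule.span_induction with
    | zero => simp
    | add a b _ _ ha hb =>
      rw [TensorProduct.add_tmul, map_add]; exact Submodule.add_mem _ ha hb
    | smul c a _ ha =>
      rw [← TensorProduct.smul_tmul', map_smul]; exact Submodule.smul_mem _ c ha
    | mem a ha =>
      obtain ⟨xs, rfl⟩ := ha
      induction hy using Submodule.span_induction with
      | zero => simp
      | add a b _ _ ha hb =>
        rw [TensorProduct.tmul_add, map_add]; exact Submodule.add_mem _ ha hb
      | smul c a _ ha =>
        rw [TensorProduct.tmul_smul, map_smul]; exact Submodule.smul_mem _ c ha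
      | mem a ha =>
        obtain ⟨ys, rfl⟩ := ha
        have h' := h xs (List.ofFn ys) (by simp)
        rw [symExtMonomial, List.map_ofFn] at h'
        rw [ExteriorAlgebra.ιMulti_apply]
        exact h'

theorem symHomotopy_formDegree_zero (ρ : ℝ →+* R) (e : P ≃ₗ[R] Q)
    {m : SymmetricAlgebra R P ⊗[R] ExteriorAlgebra R Q}
    (hm : m ∈ formDegree R (SymmetricAlgebra R P) Q 0) :
    symHomotopy ρ e.symm.toLinearMap m = 0 := by
  rw [← Submodule.mem_bot R]
  refine map_mem_of_mem_formDegree _ _ (fun xs ys hys => ?_) hm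
  rw [List.eq_nil_of_length_eq_zero hys, symExtMonomial,
    isContractingHomotopy_symHomotopy ρ e xs []]
  simp

theorem ExteriorAlgebra.list_prod_mem_exteriorPower (ys : List Q) :
    (ys.map (ExteriorAlgebra.ι R)).prod ∈ ⋀[R]^ys.length Q := by
  induction ys with
  | nil => simp
  | cons y ys ih =>
    rw [List.map_cons, List.prod_cons, List.length_cons, ExteriorAlgebra.exteriorPower, pow_succ']
    exact Submodule.mul_mem_mul ⟨y, rfl⟩ ih

theorem symHomotopy_formDegree_succ (ρ : ℝ →+* R) (e : P ≃ₗ[R] Q) {n : ℕ}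
    {m : SymmetricAlgebra R P ⊗[R] ExteriorAlgebra R Q}
    (hm : m ∈ formDegree R (SymmetricAlgebra R P) Q (n + 1)) :
    symHomotopy ρ e.symm.toLinearMap m ∈ formDegree R (SymmetricAlgebra R P) Q n := by
  refine map_mem_of_mem_formDegree _ _ (fun xs ys hys => ?_) hm
  rw [symExtMonomial, isContractingHomotopy_symHomotopy ρ e xs ys]
  refine Submodule.smul_mem _ _ (Submodule.sum_mem _ fun i _ =>
    Submodule.smul_mem _ _ (tmul_mem_formDegree _ ?_))
  have hlen : (ys.eraseIdx i).length = n := by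
    rw [List.length_eraseIdx_of_lt i.isLt, hys, Nat.add_sub_cancel]
  exact hlen ▸ ExteriorAlgebra.list_prod_mem_exteriorPower _

theorem bidegreeZero_formDegree_succ {n : ℕ}
    {m : SymmetricAlgebra R P ⊗[R] ExteriorAlgebra R Q}
    (hm : m ∈ formDegree R (SymmetricAlgebra R P) Q (n + 1)) : bidegreeZero R P Q m = 0 := by
  rw [← Submodule.mem_bot R]
  refine map_mem_of_mem_formDegree _ _ (fun xs ys hys => ?_) hm
  rw [Submodule.mem_bot]
  exact bidegreeZero_symExtMonomial xs ys (by omega)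

end Homotopy

/-! ### Normal ordering -/

section NormalOrdering

variable {R P Q : Type*} [CommRing R] [AddCommGroup P] [Module R P] [AddCommGroup Q] [Module R Q]

/-- The product in `S(P)` of the elements of two lists. -/
def symNormalMonomial (R : Type*) [CommRing R] [Module R P] (xs' xs : List P) :
    SymmetricAlgebra R P :=
  (xs'.map (SymmetricAlgebra.ι R P)).prod * (xs.map (SymmetricAlgebra.ι R P)).prod

theorem symNormalMonomial_cons_left (x : P) (xs' xs : List P) :
    symNormalMonomial R (x :: xs') xs
      = SymmetricAlgebra.ι R P x * symNormalMonomial R xs' xs := by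
  simp [symNormalMonomial, mul_assoc]

theorem symNormalMonomial_cons_right (x : P) (xs' xs : List P) :
    symNormalMonomial R xs' (x :: xs)
      = SymmetricAlgebra.ι R P x * symNormalMonomial R xs' xs := by
  simp [symNormalMonomial, mul_left_comm]

/-- Two linear maps on `S(P)` which agree on the products of elements of `L'` and of elements of
`L` are equal, if `P = L + L'`. -/
theorem symNormalMonomial_hom_ext {X : Type*} [AddCommGroup X] [Module R X] {L L' : Submodule R P}
    {p : P →ₗ[R] P} (hp : ∀ x, p x ∈ L) (hp' : ∀ x, x - p x ∈ L')
    {f g : SymmetricAlgebra R P →ₗ[R] X}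
    (h : ∀ xs' xs : List P, (∀ x ∈ xs', x ∈ L') → (∀ x ∈ xs, x ∈ L) →
      f (symNormalMonomial R xs' xs) = g (symNormalMonomial R xs' xs)) : f = g := by
  ext s
  suffices hs : s ∈ Submodule.span R {t | ∃ xs' xs : List P, (∀ x ∈ xs', x ∈ L') ∧
      (∀ x ∈ xs, x ∈ L) ∧ symNormalMonomial R xs' xs = t} by
    induction hs using Submodule.span_induction with
    | zero => simp
    | add a b _ _ ha hb => rw [map_add, map_add, ha, hb]
    | smul c a _ ha => rw [map_smul, map_smul, ha]
    | mem a ha => obtain ⟨xs', xs, h1, h2, rfl⟩ := ha; exact h xs' xs h1 h2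
  induction s using TensorAlgebra.induction_left (SymmetricAlgebra.algHom_surjective R P) with
  | one => exact Submodule.subset_span ⟨[], [], by simp, by simp, by simp [symNormalMonomial]⟩
  | add a b ha hb => exact Submodule.add_mem _ ha hb
  | smul c a ha => exact Submodule.smul_mem _ c ha
  | mul x a ha =>
    change SymmetricAlgebra.ι R P x * a ∈ _
    induction ha using Submodule.span_induction with
    | zero => simp
    | add a b _ _ ha hb => rw [mul_add]; exact Submodule.add_mem _ ha hb
    | smul c a _ ha => rw [mul_smul_comm]; exact Submodule.smul_mem _ c ha
    | mem a ha =>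
      obtain ⟨xs', xs, h1, h2, rfl⟩ := ha
      conv in SymmetricAlgebra.ι R P x => rw [← sub_add_cancel x (p x), map_add]
      rw [add_mul, ← symNormalMonomial_cons_left, ← symNormalMonomial_cons_right]
      exact Submodule.add_mem _
        (Submodule.subset_span ⟨_, _, List.forall_mem_cons.mpr ⟨hp' x, h1⟩, h2, rfl⟩)
        (Submodule.subset_span ⟨_, _, h1, List.forall_mem_cons.mpr ⟨hp x, h2⟩, rfl⟩)

/-- The normal ordering map exists: it is the composition of the comultiplication
`S(P) → S(P) ⊗ S(P)` defined by the decomposition with the multiplication of `W(P)`. -/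
theorem exists_isNormalOrdering (Ω : LinearMap.BilinForm R P) (l : R) {L L' : Submodule R P}
    (hL : ∀ x ∈ L, ∀ y ∈ L, Ω x y = 0) (hL' : ∀ x ∈ L', ∀ y ∈ L', Ω x y = 0)
    {p : P →ₗ[R] P} (hp : ∀ x, p x ∈ L) (hp' : ∀ x, x - p x ∈ L')
    (hpL : ∀ x ∈ L, p x = x) (hpL' : ∀ x ∈ L', p x = 0) :
    ∃ π, IsNormalOrdering Ω l L L' π := by
  have hcomm : ∀ x y, Ω x y = 0 → weylι Ω l x * weylι Ω l y = weylι Ω l y * weylι Ω l x := by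
    intro x y h
    rw [← sub_eq_zero, weylι_mul_sub, h, mul_zero, map_zero]
  let α' : SymmetricAlgebra R P →ₐ[R] WeylAlgebra Ω l :=
    SymmetricAlgebra.liftOfCommute (weylι Ω l ∘ₗ (LinearMap.id - p))
      fun x y => hcomm _ _ (hL' _ (hp' x) _ (hp' y))
  let α : SymmetricAlgebra R P →ₐ[R] WeylAlgebra Ω l :=
    SymmetricAlgebra.liftOfCommute (weylι Ω l ∘ₗ p) fun x y => hcomm _ _ (hL _ (hp x) _ (hp y))
  let Δ : SymmetricAlgebra R P →ₐ[R] SymmetricAlgebra R P ⊗[R] SymmetricAlgebra R P :=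
    SymmetricAlgebra.liftOfCommute
      ((Algebra.TensorProduct.includeLeft (R := R) (S := R)).toLinearMap ∘ₗ
          SymmetricAlgebra.ι R P ∘ₗ (LinearMap.id - p)
        + (Algebra.TensorProduct.includeRight (R := R)).toLinearMap ∘ₗ SymmetricAlgebra.ι R P ∘ₗ p)
      fun x y => mul_comm _ _
  refine ⟨TensorProduct.lift ((LinearMap.mul R (WeylAlgebra Ω l)).compl₁₂ α'.toLinearMap
    α.toLinearMap) ∘ₗ Δ.toLinearMap, fun xs' xs h' h => ?_⟩
  have h1 : Δ (xs'.map (SymmetricAlgebra.ι R P)).prod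
      = (xs'.map (SymmetricAlgebra.ι R P)).prod ⊗ₜ 1 := by
    induction xs' with
    | nil => simp [Algebra.TensorProduct.one_def]
    | cons x xs' ih =>
      rw [List.forall_mem_cons] at h'
      rw [List.map_cons, List.prod_cons, map_mul, ih h'.2]
      simp [Δ, SymmetricAlgebra.liftOfCommute_ι, hpL' x h'.1]
  have h2 : Δ (xs.map (SymmetricAlgebra.ι R P)).prod
      = 1 ⊗ₜ (xs.map (SymmetricAlgebra.ι R P)).prod := by
    induction xs with
    | nil => simp [Algebra.TensorProduct.one_def]
    | cons x xs ih =>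
      rw [List.forall_mem_cons] at h
      rw [List.map_cons, List.prod_cons, map_mul, ih h.2]
      simp [Δ, SymmetricAlgebra.liftOfCommute_ι, hpL x h.1]
  have h3 : α' (xs'.map (SymmetricAlgebra.ι R P)).prod = (xs'.map (weylι Ω l)).prod := by
    rw [map_list_prod, List.map_map]
    congr 1
    refine List.map_congr_left fun x hx => ?_
    simp [α', SymmetricAlgebra.liftOfCommute_ι, hpL' x (h' x hx)]
  have h4 : α (xs.map (SymmetricAlgebra.ι R P)).prod = (xs.map (weylι Ω l)).prod := by
    rw [map_list_prod, List.map_map]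
    congr 1
    refine List.map_congr_left fun x hx => ?_
    simp [α, SymmetricAlgebra.liftOfCommute_ι, hpL x (h x hx)]
  simp [h1, h2, h3, h4]

/-- The derivations of `S(P)` extending linear forms on `P`, depending linearly on the form. -/
theorem exists_symDerivation (R P : Type*) [CommRing R] [AddCommGroup P] [Module R P] :
    ∃ D : Module.Dual R P →ₗ[R] Module.End R (SymmetricAlgebra R P),
      (∀ ξ, D ξ 1 = 0) ∧ ∀ ξ x s, D ξ (SymmetricAlgebra.ι R P x * s)
        = SymmetricAlgebra.ι R P x * D ξ s + ξ x • s := by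
  obtain ⟨δ, hδ⟩ := exists_isKoszul_symmetricAlgebra (LinearMap.id (R := R) (M := P))
  -- The derivative along `ξ` is the contraction of the universal derivative `δ(s ⊗ 1)` with `ξ`.
  let c : Module.Dual R P → SymmetricAlgebra R P ⊗[R] ExteriorAlgebra R P →ₗ[R]
      SymmetricAlgebra R P := fun ξ =>
    (TensorProduct.rid R (SymmetricAlgebra R P)).toLinearMap ∘ₗ
      (ξ ∘ₗ ExteriorAlgebra.ιInv).lTensor (SymmetricAlgebra R P)
  have hc : ∀ ξ x m, c ξ ((SymmetricAlgebra.ι R P x ⊗ₜ 1) * m)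
      = SymmetricAlgebra.ι R P x * c ξ m := by
    intro ξ x m
    induction m using TensorProduct.induction_on with
    | zero => simp
    | add m m' h h' => rw [mul_add, map_add, h, h', map_add, mul_add]
    | tmul a y => simp [c]
  refine ⟨LinearMap.mk₂ R (fun ξ s => c ξ (δ (s ⊗ₜ 1))) ?_ ?_ ?_ ?_, fun ξ => ?_, fun ξ x s => ?_⟩
  · intro ξ η s
    simp [c, LinearMap.add_comp, LinearMap.lTensor_add]
  · intro a ξ s
    simp [c, LinearMap.smul_comp, LinearMap.lTensor_smul]
  · intro ξ s t
    simp [TensorProduct.add_tmul]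
  · intro a ξ s
    simp [← TensorProduct.smul_tmul']
  · simp [hδ.one_tmul]
  · have h := hδ.ι_mul_tmul x s 1
    change δ ((SymmetricAlgebra.ι R P x * s) ⊗ₜ 1) = (SymmetricAlgebra.ι R P x ⊗ₜ 1) * _ + _ at h
    rw [LinearMap.mk₂_apply, h, map_add, hc]
    simp [c, ExteriorAlgebra.ι_leftInverse x]

theorem symDerivation_comm {D : Module.Dual R P →ₗ[R] Module.End R (SymmetricAlgebra R P)}
    (h1 : ∀ ξ, D ξ 1 = 0) (h2 : ∀ ξ x s, D ξ (SymmetricAlgebra.ι R P x * s)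
        = SymmetricAlgebra.ι R P x * D ξ s + ξ x • s) (ξ η : Module.Dual R P)
    (s : SymmetricAlgebra R P) : D ξ (D η s) = D η (D ξ s) := by
  induction s using TensorAlgebra.induction_left (SymmetricAlgebra.algHom_surjective R P) with
  | one => simp [h1]
  | add a b ha hb => simp [ha, hb]
  | smul c a ha => simp [ha]
  | mul x a ha =>
    change D ξ (D η (SymmetricAlgebra.ι R P x * a)) = D η (D ξ (SymmetricAlgebra.ι R P x * a))
    simp only [h2, map_add, map_smul, ha]
    abel

/-- The derivations of `S(P)` with constant values on `P` commute with the Koszul differential. -/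
theorem koszul_comp_symDerivation
    {D : Module.Dual R P →ₗ[R] Module.End R (SymmetricAlgebra R P)}
    (h1 : ∀ ξ, D ξ 1 = 0) (h2 : ∀ ξ x s, D ξ (SymmetricAlgebra.ι R P x * s)
        = SymmetricAlgebra.ι R P x * D ξ s + ξ x • s) {u : P →ₗ[R] Q}
    {δ : SymmetricAlgebra R P ⊗[R] ExteriorAlgebra R Q →ₗ[R]
      SymmetricAlgebra R P ⊗[R] ExteriorAlgebra R Q}
    (hδ : IsKoszul u (SymmetricAlgebra.algHom R P) δ) (ξ : Module.Dual R P)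
    (m : SymmetricAlgebra R P ⊗[R] ExteriorAlgebra R Q) :
    δ ((D ξ).rTensor (ExteriorAlgebra R Q) m) = (D ξ).rTensor (ExteriorAlgebra R Q) (δ m) := by
  have hD : ∀ x m, (D ξ).rTensor (ExteriorAlgebra R Q) ((SymmetricAlgebra.ι R P x ⊗ₜ 1) * m)
      = (SymmetricAlgebra.ι R P x ⊗ₜ 1) * (D ξ).rTensor (ExteriorAlgebra R Q) m + ξ x • m := by
    intro x m
    induction m using TensorProduct.induction_on with
    | zero => simp
    | add m m' h h' => rw [mul_add, map_add, h, h', map_add, mul_add, smul_add]; abel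
    | tmul a y => simp [h2, TensorProduct.add_tmul, TensorProduct.smul_tmul']
  have hX : ∀ x a y, δ ((SymmetricAlgebra.ι R P x * a) ⊗ₜ y)
    = (SymmetricAlgebra.ι R P x ⊗ₜ 1) * δ (a ⊗ₜ y) + a ⊗ₜ (ExteriorAlgebra.ι R (u x) * y) :=
    hδ.ι_mul_tmul
  induction m using TensorProduct.induction_on with
  | zero => simp
  | add m m' h h' => simp only [map_add, h, h']
  | tmul a y =>
    rw [LinearMap.rTensor_tmul]
    induction a using TensorAlgebra.induction_left (SymmetricAlgebra.algHom_surjective R P) with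
    | one => simp [h1, hδ.one_tmul]
    | add a b ha hb => simp only [TensorProduct.add_tmul, map_add, ha, hb]
    | smul c a ha => simp only [← TensorProduct.smul_tmul', map_smul, ha]
    | mul x a ha =>
      change δ (D ξ (SymmetricAlgebra.ι R P x * a) ⊗ₜ y)
        = (D ξ).rTensor _ (δ ((SymmetricAlgebra.ι R P x * a) ⊗ₜ y))
      rw [h2, TensorProduct.add_tmul, map_add, hX, hX, map_add, hD, ha, LinearMap.rTensor_tmul,
        ← TensorProduct.smul_tmul', map_smul]
      abel

/-- The normal ordering map is bijective and commutes with the Koszul differentials. Its inverse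
evaluates at `1` the action of `W(P)` on `S(P)` in which `x ∈ P` acts by the multiplication by `x`
plus `l` times the derivation `y ↦ Ω(p(x), y - p(y))`. -/
theorem IsNormalOrdering.exists_inverse {Ω : LinearMap.BilinForm R P} {l : R}
    {L L' : Submodule R P} (hΩ : ∀ x y, Ω y x = -Ω x y)
    (hL : ∀ x ∈ L, ∀ y ∈ L, Ω x y = 0) (hL' : ∀ x ∈ L', ∀ y ∈ L', Ω x y = 0)
    {p : P →ₗ[R] P} (hp : ∀ x, p x ∈ L) (hp' : ∀ x, x - p x ∈ L')
    (hpL : ∀ x ∈ L, p x = x) (hpL' : ∀ x ∈ L', p x = 0)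
    {π : SymmetricAlgebra R P →ₗ[R] WeylAlgebra Ω l} (hπ : IsNormalOrdering Ω l L L' π)
    {u : P →ₗ[R] Q}
    {δS : SymmetricAlgebra R P ⊗[R] ExteriorAlgebra R Q →ₗ[R]
      SymmetricAlgebra R P ⊗[R] ExteriorAlgebra R Q}
    (hδS : IsKoszul u (SymmetricAlgebra.algHom R P) δS)
    {δW : WeylAlgebra Ω l ⊗[R] ExteriorAlgebra R Q →ₗ[R] WeylAlgebra Ω l ⊗[R] ExteriorAlgebra R Q}
    (hδW : IsKoszul u (weylMk Ω l) δW) :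
    ∃ σ : WeylAlgebra Ω l →ₗ[R] SymmetricAlgebra R P,
      σ ∘ₗ π = LinearMap.id ∧ π ∘ₗ σ = LinearMap.id ∧
      σ.rTensor (ExteriorAlgebra R Q) ∘ₗ δW = δS ∘ₗ σ.rTensor (ExteriorAlgebra R Q) := by
  obtain ⟨D, hD1, hD2⟩ := exists_symDerivation R P
  let ξ : P →ₗ[R] Module.Dual R P := Ω.compl₁₂ p (LinearMap.id - p)
  have hξ : ∀ x y, ξ x y = Ω (p x) (y - p y) := fun x y => rfl
  let f : P →ₗ[R] Module.End R (SymmetricAlgebra R P) :=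
    LinearMap.mul R (SymmetricAlgebra R P) ∘ₗ SymmetricAlgebra.ι R P + l • (D ∘ₗ ξ)
  have hf : ∀ x s, f x s = SymmetricAlgebra.ι R P x * s + l • D (ξ x) s := fun x s => rfl
  have hrel : ∀ x y, f x * f y - f y * f x
      = algebraMap R (Module.End R (SymmetricAlgebra R P)) (l * Ω x y) := by
    intro x y
    have hxy : Ω x y = ξ x y - ξ y x := by
      have e1 : Ω x y = Ω (p x + (x - p x)) (p y + (y - p y)) := by simp
      rw [e1, hξ, hξ, map_add, map_add, LinearMap.add_apply, LinearMap.add_apply,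
        hL _ (hp x) _ (hp y), hL' _ (hp' x) _ (hp' y), hΩ (p y) (x - p x)]
      ring
    refine LinearMap.ext fun s => ?_
    rw [hxy, LinearMap.sub_apply, Module.End.mul_apply, Module.End.mul_apply,
      Module.algebraMap_end_apply]
    simp only [hf, hD2, map_add, map_smul, symDerivation_comm hD1 hD2 (ξ x) (ξ y), mul_add,
      smul_add, mul_smul_comm, mul_left_comm (SymmetricAlgebra.ι R P x), mul_sub, sub_smul,
      smul_smul]
    abel
  let act := weylLift Ω l f hrel
  let σ : WeylAlgebra Ω l →ₗ[R] SymmetricAlgebra R P :=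
    (LinearMap.applyₗ (1 : SymmetricAlgebra R P)) ∘ₗ act.toLinearMap
  have hσ : ∀ w, σ w = act w 1 := fun w => rfl
  have hσ1 : σ 1 = 1 := by rw [hσ, map_one act]; rfl
  have hσmul : ∀ x w, σ (weylι Ω l x * w) = f x (σ w) := by
    intro x w
    rw [hσ, map_mul, Module.End.mul_apply, weylLift_ι, ← hσ]
  have hfL' : ∀ x ∈ L', ∀ s, f x s = SymmetricAlgebra.ι R P x * s := by
    intro x hx s
    have : ξ x = 0 := by ext y; simp [hξ, hpL' x hx]
    simp [hf, this]
  -- The derivations appearing in the action vanish on products of elements of `L`.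
  have hDL : ∀ x (xs : List P), (∀ y ∈ xs, y ∈ L) →
      D (ξ x) (xs.map (SymmetricAlgebra.ι R P)).prod = 0 := by
    intro x xs hxs
    induction xs with
    | nil => simp [hD1]
    | cons y xs ih =>
      rw [List.forall_mem_cons] at hxs
      simp [hD2, ih hxs.2, hξ, hpL y hxs.1]
  have hπL' : ∀ x ∈ L', ∀ s, π (SymmetricAlgebra.ι R P x * s) = weylι Ω l x * π s := by
    intro x hx s
    have : π ∘ₗ LinearMap.mulLeft R (SymmetricAlgebra.ι R P x)
        = LinearMap.mulLeft R (weylι Ω l x) ∘ₗ π := by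
      refine symNormalMonomial_hom_ext hp hp' fun xs' xs h1 h2 => ?_
      simp only [LinearMap.comp_apply, LinearMap.mulLeft_apply]
      rw [← symNormalMonomial_cons_left, symNormalMonomial, symNormalMonomial, hπ xs' xs h1 h2,
        hπ (x :: xs') xs (List.forall_mem_cons.mpr ⟨hx, h1⟩) h2, List.map_cons, List.prod_cons,
        mul_assoc]
    exact LinearMap.congr_fun this s
  -- The normal ordering map intertwines the two actions of `W(P)`.
  have hπf : ∀ x s, π (f x s) = weylι Ω l x * π s := by
    have key : ∀ x ∈ L, ∀ s, π (f x s) = weylι Ω l x * π s := by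
      intro x hx s
      have : π ∘ₗ f x = LinearMap.mulLeft R (weylι Ω l x) ∘ₗ π := by
        refine symNormalMonomial_hom_ext hp hp' fun xs' xs h1 h2 => ?_
        simp only [LinearMap.comp_apply, LinearMap.mulLeft_apply]
        induction xs' with
        | nil =>
          have e1 := hπ [] (x :: xs) (by simp) (List.forall_mem_cons.mpr ⟨hx, h2⟩)
          have e2 := hπ [] xs (by simp) h2
          simp only [List.map_nil, List.prod_nil, one_mul, List.map_cons, List.prod_cons] at e1 e2
          rw [symNormalMonomial, List.map_nil, List.prod_nil, one_mul, hf, hDL x xs h2, smul_zero,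
            add_zero, e1, e2]
        | cons y xs' ih =>
          rw [List.forall_mem_cons] at h1
          have e := LinearMap.congr_fun (hrel x y) (symNormalMonomial R xs' xs)
          rw [LinearMap.sub_apply, Module.End.mul_apply, Module.End.mul_apply,
            Module.algebraMap_end_apply, hfL' y h1.1, hfL' y h1.1, sub_eq_iff_eq_add] at e
          rw [symNormalMonomial_cons_left, e, map_add, map_smul, hπL' y h1.1, hπL' y h1.1,
            ih h1.2, ← mul_assoc, ← mul_assoc, Algebra.smul_def, ← weylι_mul_sub, sub_mul,
            sub_add_cancel]
      exact LinearMap.congr_fun this s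
    intro x s
    have e : x = (x - p x) + p x := by simp
    rw [e, map_add, map_add, LinearMap.add_apply, map_add, key _ (hp x), hfL' _ (hp' x),
      hπL' _ (hp' x), add_mul]
  have hπ1 : π 1 = 1 := by simpa using hπ [] [] (by simp) (by simp)
  refine ⟨σ, ?_, ?_, ?_⟩
  · refine symNormalMonomial_hom_ext hp hp' fun xs' xs h1 h2 => ?_
    rw [LinearMap.comp_apply, symNormalMonomial, hπ xs' xs h1 h2, LinearMap.id_apply]
    induction xs' with
    | cons x xs' ih =>
      rw [List.forall_mem_cons] at h1
      rw [List.map_cons, List.map_cons, List.prod_cons, List.prod_cons, mul_assoc, hσmul,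
        ih h1.2, hfL' x h1.1, mul_assoc]
    | nil =>
      simp only [List.map_nil, List.prod_nil, one_mul]
      induction xs with
      | nil => simp [hσ1]
      | cons x xs ih =>
        rw [List.forall_mem_cons] at h2
        rw [List.map_cons, List.map_cons, List.prod_cons, List.prod_cons, hσmul, ih h2.2, hf,
          hDL x xs h2.2, smul_zero, add_zero]
  · ext w
    simp only [LinearMap.comp_apply, LinearMap.id_apply]
    induction w using TensorAlgebra.induction_left (weylMk_surjective Ω l) with
    | one => rw [hσ1, hπ1]
    | add a b ha hb => rw [map_add, map_add, ha, hb]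
    | smul c a ha => rw [map_smul, map_smul, ha]
    | mul x a ha => rw [weylι_apply, hσmul, hπf, ha]
  · have hX : ∀ x a y, δW ((weylι Ω l x * a) ⊗ₜ y)
      = (weylι Ω l x ⊗ₜ 1) * δW (a ⊗ₜ y) + a ⊗ₜ (ExteriorAlgebra.ι R (u x) * y) :=
      hδW.ι_mul_tmul
    have hXS : ∀ x a y, δS ((SymmetricAlgebra.ι R P x * a) ⊗ₜ y)
      = (SymmetricAlgebra.ι R P x ⊗ₜ 1) * δS (a ⊗ₜ y) + a ⊗ₜ (ExteriorAlgebra.ι R (u x) * y) :=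
      hδS.ι_mul_tmul
    have hσm : ∀ x m, σ.rTensor (ExteriorAlgebra R Q) ((weylι Ω l x ⊗ₜ 1) * m)
        = (SymmetricAlgebra.ι R P x ⊗ₜ 1) * σ.rTensor (ExteriorAlgebra R Q) m
          + l • (D (ξ x)).rTensor (ExteriorAlgebra R Q)
            (σ.rTensor (ExteriorAlgebra R Q) m) := by
      intro x m
      induction m using TensorProduct.induction_on with
      | zero => simp
      | add m m' h h' => rw [mul_add, map_add, h, h', map_add, mul_add, map_add, smul_add]; abel
      | tmul a y => simp [hσmul, hf, TensorProduct.add_tmul, TensorProduct.smul_tmul']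
    refine TensorProduct.ext' fun w y => ?_
    simp only [LinearMap.comp_apply, LinearMap.rTensor_tmul]
    induction w using TensorAlgebra.induction_left (weylMk_surjective Ω l) with
    | one => simp [hσ1, hδS.one_tmul, hδW.one_tmul]
    | add a b ha hb => simp only [TensorProduct.add_tmul, map_add, ha, hb]
    | smul c a ha => simp only [← TensorProduct.smul_tmul', map_smul, ha]
    | mul x a ha =>
      have hD := koszul_comp_symDerivation hD1 hD2 hδS (ξ x) (σ a ⊗ₜ y)
      rw [LinearMap.rTensor_tmul] at hD
      rw [weylι_apply, hX, map_add, hσm, ha, hσmul, hf, TensorProduct.add_tmul, map_add, hXS,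
        ← TensorProduct.smul_tmul', map_smul, hD,
        LinearMap.rTensor_tmul]
      abel

end NormalOrdering

/-! ### The Koszul complex of the Weyl algebra -/

section Transport

variable {R P Q : Type*} [CommRing R] [AddCommGroup P] [Module R P] [AddCommGroup Q] [Module R Q]

theorem rTensor_mem_formDegree {X Y : Type*} [AddCommGroup X] [Module R X] [AddCommGroup Y]
    [Module R Y] (f : X →ₗ[R] Y) {n : ℕ} {m : X ⊗[R] ExteriorAlgebra R Q}
    (hm : m ∈ formDegree R X Q n) :
    f.rTensor (ExteriorAlgebra R Q) m ∈ formDegree R Y Q n := by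
  obtain ⟨m, rfl⟩ := hm
  exact ⟨f.rTensor _ m, by
    rw [← LinearMap.comp_apply, ← LinearMap.comp_apply, LinearMap.lTensor_comp_rTensor,
      LinearMap.rTensor_comp_lTensor]⟩

/-- The augmentation of `S(P) ⊗ ∧Q`. -/
def symExtAugmentation (R P Q : Type*) [CommRing R] [AddCommGroup P] [Module R P]
    [AddCommGroup Q] [Module R Q] : SymmetricAlgebra R P ⊗[R] ExteriorAlgebra R Q →ₗ[R] R :=
  LinearMap.mul' R R ∘ₗ TensorProduct.map
    (SymmetricAlgebra.algebraMapInv (R := R) (M := P)).toLinearMap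
    (ExteriorAlgebra.algebraMapInv (R := R) (M := Q)).toLinearMap

theorem bidegreeZero_eq_augmentation (m : SymmetricAlgebra R P ⊗[R] ExteriorAlgebra R Q) :
    bidegreeZero R P Q m = symExtAugmentation R P Q m • (1 ⊗ₜ[R] 1) := by
  induction m using TensorProduct.induction_on with
  | zero => simp
  | add m m' h h' => rw [map_add, h, h', map_add, add_smul]
  | tmul s y =>
    simp [bidegreeZero, symExtAugmentation, Algebra.algebraMap_eq_smul_one,
      TensorProduct.smul_tmul', smul_smul, mul_comm]

theorem cohomology_subsingleton {X : Type*} [AddCommGroup X] [Module R X]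
    (d : X ⊗[R] ExteriorAlgebra R Q →ₗ[R] X ⊗[R] ExteriorAlgebra R Q) (n : ℕ)
    (h : cocycles R X Q d n ≤ coboundaries R X Q d n) : Subsingleton (Cohomology R X Q d n) := by
  rw [Submodule.Quotient.subsingleton_iff, Submodule.comap_subtype_eq_top]
  exact h

/-- There are no coboundaries in degree zero, so that `H⁰ = R` as soon as the cocycles of degree
zero are the multiples of `1 ⊗ 1`. -/
theorem exists_equiv_cohomology_zero {X : Type*} [Ring X] [Algebra R X]
    (d : X ⊗[R] ExteriorAlgebra R Q →ₗ[R] X ⊗[R] ExteriorAlgebra R Q)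
    (hd : d (1 ⊗ₜ 1) = 0)
    (hinj : ∀ c : R, c • ((1 : X) ⊗ₜ[R] (1 : ExteriorAlgebra R Q)) = 0 → c = 0)
    (hsurj : ∀ z ∈ cocycles R X Q d 0, ∃ c : R, z = c • (1 ⊗ₜ[R] 1)) :
    ∃ f : R ≃ₗ[R] Cohomology R X Q d 0, ∀ c : R, ∃ z : cocycles R X Q d 0,
      (z : X ⊗[R] ExteriorAlgebra R Q) = c • (1 ⊗ₜ[R] 1) ∧ f c = cohomologyClass z := by
  have h1 : (1 : X) ⊗ₜ[R] (1 : ExteriorAlgebra R Q) ∈ cocycles R X Q d 0 := by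
    refine ⟨tmul_mem_formDegree _ ?_, hd⟩
    rw [ExteriorAlgebra.exteriorPower, pow_zero]
    exact Submodule.mem_one.mpr ⟨1, map_one _⟩
  let g : R →ₗ[R] cocycles R X Q d 0 := LinearMap.toSpanSingleton R _ ⟨_, h1⟩
  have hg : ∀ c, (g c : X ⊗[R] ExteriorAlgebra R Q) = c • (1 ⊗ₜ[R] 1) := fun c => rfl
  have hker : ∀ z : cocycles R X Q d 0, cohomologyClass z = 0 → z = 0 := by
    intro z hz
    rw [cohomologyClass, Submodule.Quotient.mk_eq_zero, Submodule.mem_comap] at hz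
    exact Subtype.ext hz
  refine ⟨LinearEquiv.ofBijective (Submodule.mkQ _ ∘ₗ g) ⟨?_, ?_⟩, fun c => ⟨g c, hg c, rfl⟩⟩
  · rw [← LinearMap.ker_eq_bot, LinearMap.ker_eq_bot']
    intro c hc
    refine hinj c ?_
    rw [← hg, hker (g c) hc, ZeroMemClass.coe_zero]
  · intro z
    obtain ⟨z, rfl⟩ := Submodule.mkQ_surjective _ z
    obtain ⟨c, hc⟩ := hsurj z z.2
    exact ⟨c, congrArg _ (Subtype.ext hc.symm)⟩

/-- The assertions about the Koszul complexes, for a module with an antisymmetric form, a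
decomposition into isotropic submodules given by a projection, and an isomorphism `e`. -/
theorem exists_koszulTransport (ρ : ℝ →+* R) (Ω : LinearMap.BilinForm R P) (l : R)
    (L L' : Submodule R P) (hΩ : ∀ x y, Ω y x = -Ω x y)
    (hL : ∀ x ∈ L, ∀ y ∈ L, Ω x y = 0) (hL' : ∀ x ∈ L', ∀ y ∈ L', Ω x y = 0)
    {p : P →ₗ[R] P} (hp : ∀ x, p x ∈ L) (hp' : ∀ x, x - p x ∈ L')
    (hpL : ∀ x ∈ L, p x = x) (hpL' : ∀ x ∈ L', p x = 0) (e : P ≃ₗ[R] Q) :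
    ∃ δS δW π h, KoszulTransport ρ Ω l e.toLinearMap L L' δS δW π e h := by
  obtain ⟨δS, hδS⟩ := exists_isKoszul_symmetricAlgebra e.toLinearMap
  obtain ⟨δW, hδW⟩ := exists_isKoszul_weylAlgebra e.toLinearMap Ω l
  obtain ⟨π₀, hπ⟩ := exists_isNormalOrdering Ω l hL hL' hp hp' hpL hpL'
  obtain ⟨σ, hσπ, hπσ, hσδ⟩ := hπ.exists_inverse hΩ hL hL' hp hp' hpL hpL' hδS hδW
  let π : SymmetricAlgebra R P ≃ₗ[R] WeylAlgebra Ω l := LinearEquiv.ofLinearMap π₀ σ hπσ hσπ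
  let Φ := π.rTensor (ExteriorAlgebra R Q)
  have hΦ : ∀ m, Φ m = π₀.rTensor (ExteriorAlgebra R Q) m := fun m => rfl
  have hΦs : ∀ m, Φ.symm m = σ.rTensor (ExteriorAlgebra R Q) m := fun m => rfl
  have hΦ1 : Φ (1 ⊗ₜ 1) = 1 ⊗ₜ 1 := by
    have hπ1 : π₀ 1 = 1 := by simpa using hπ [] [] (by simp) (by simp)
    rw [hΦ, LinearMap.rTensor_tmul, hπ1]
  have hconj : Φ.conj δS = δW := by
    refine LinearMap.ext fun m => ?_
    have h := LinearMap.congr_fun hσδ m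
    rw [LinearMap.comp_apply, LinearMap.comp_apply, ← hΦs, ← hΦs] at h
    rw [LinearEquiv.conj_apply_apply, ← h, LinearEquiv.apply_symm_apply]
  let h := symHomotopy ρ e.symm.toLinearMap
  have hS := symHomotopy_add ρ e hδS
  have hW : δW ∘ₗ Φ.conj h + Φ.conj h ∘ₗ δW + Φ.conj (bidegreeZero R P Q) = LinearMap.id := by
    have := congrArg Φ.conj hS
    rwa [map_add, map_add, LinearEquiv.conj_comp, LinearEquiv.conj_comp, hconj,
      LinearEquiv.conj_id] at this
  -- A cocycle is the sum of a coboundary and of its component of bidegree `(0, 0)`.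
  have hcocycle : ∀ z, δW z = 0 →
      z = δW (Φ (h (Φ.symm z))) + Φ (bidegreeZero R P Q (Φ.symm z)) := by
    intro z hz
    have := LinearMap.congr_fun hW z
    simp only [LinearMap.add_apply, LinearMap.comp_apply, hz, map_zero, add_zero,
      LinearEquiv.conj_apply_apply, LinearMap.id_apply] at this
    exact this.symm
  refine ⟨δS, δW, π, h,
    { koszul_sq := (isKoszul_koszul _).comp_self
      descends_S := (isKoszul_koszul _).comp_rTensor hδS _ (AlgHom.comp_id _)
      descends_W := (isKoszul_koszul _).comp_rTensor hδW _ (AlgHom.comp_id _)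
      normalOrdering := hπ
      normalOrdering_unique := fun π' hπ' => symNormalMonomial_hom_ext hp hp'
        fun xs' xs h1 h2 => (hπ' xs' xs h1 h2).trans (hπ xs' xs h1 h2).symm
      commutes := ?_
      iso := rfl
      homotopy := isContractingHomotopy_symHomotopy ρ e
      homotopy_S := hS
      homotopy_W := hW
      sq_W := hδW.comp_self
      degree_W := hδW.map_formDegree_le
      cohomology_zero := exists_equiv_cohomology_zero δW (hδW.one_tmul 1) ?_ ?_
      cohomology_pos := ?_ }⟩
  · refine LinearMap.ext fun m => ?_
    rw [← hconj]
    change Φ (δS m) = Φ.conj δS (Φ m)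
    rw [LinearEquiv.conj_apply_apply, LinearEquiv.symm_apply_apply]
  · intro c hc
    rw [← hΦ1, ← map_smul, LinearEquiv.map_eq_zero_iff] at hc
    simpa [symExtAugmentation] using congrArg (symExtAugmentation R P Q) hc
  · rintro z ⟨hz0, hz⟩
    have hh : h (Φ.symm z) = 0 := symHomotopy_formDegree_zero ρ e (rTensor_mem_formDegree σ hz0)
    refine ⟨symExtAugmentation R P Q (Φ.symm z), ?_⟩
    conv_lhs => rw [hcocycle z hz, hh, bidegreeZero_eq_augmentation]
    rw [map_zero, map_zero, zero_add, map_smul, hΦ1]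
  · intro n hn
    obtain ⟨n, rfl⟩ := Nat.exists_eq_succ_of_ne_zero hn.ne'
    refine cohomology_subsingleton δW _ ?_
    rintro z ⟨hz0, hz⟩
    have hz' := rTensor_mem_formDegree σ hz0
    rw [hcocycle z hz]
    rw [hΦs, bidegreeZero_formDegree_succ hz', map_zero, add_zero]
    exact ⟨_, rTensor_mem_formDegree π₀ (symHomotopy_formDegree_succ ρ e hz'), rfl⟩

end Transport

/-! ### Transversal Lagrangian distributions -/

section LinearAlgebra

variable {T : Type*} [AddCommGroup T] [Module ℝ T] {n : ℕ}

/-- Cramer's rule for the coordinates of a vector in a frame adapted to two isotropic subspaces,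
computed from the pairing matrix of the two parts of the frame. -/
theorem det_smul_eq_sum_of_isotropic {β : T →ₗ[ℝ] T →ₗ[ℝ] ℝ} (hβ : ∀ v w, β w v = -β v w)
    {X Y : Fin n → T} (hX : ∀ i j, β (X i) (X j) = 0) (hY : ∀ i j, β (Y i) (Y j) = 0)
    {G : Matrix (Fin n) (Fin n) ℝ} (hG : ∀ i j, G i j = β (X i) (Y j)) {z : T}
    (hz : z ∈ Submodule.span ℝ (Set.range X) ⊔ Submodule.span ℝ (Set.range Y)) :
    G.det • z = ∑ i, β z (∑ j, G.adjugate j i • Y j) • X i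
      + ∑ j, β z (-∑ k, G.adjugate j k • X k) • Y j := by
  have h1 : ∀ i i', ∑ j, G i j * G.adjugate j i' = if i = i' then G.det else 0 := by
    intro i i'
    rw [← Matrix.mul_apply, Matrix.mul_adjugate, Matrix.smul_apply, Matrix.one_apply]
    simp
  have h2 : ∀ j j', ∑ k, G.adjugate j k * G k j' = if j = j' then G.det else 0 := by
    intro i i'
    rw [← Matrix.mul_apply, Matrix.adjugate_mul, Matrix.smul_apply, Matrix.one_apply]
    simp
  -- Both sides are linear in `z`, so it suffices to consider the vectors of the frame.
  suffices h : Submodule.span ℝ (Set.range X) ⊔ Submodule.span ℝ (Set.range Y) ≤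
      LinearMap.eqLocus (G.det • (LinearMap.id : T →ₗ[ℝ] T))
        (∑ i, (β.flip (∑ j, G.adjugate j i • Y j)).smulRight (X i)
          + ∑ j, (β.flip (-∑ k, G.adjugate j k • X k)).smulRight (Y j)) by
    simpa using h hz
  refine sup_le (Submodule.span_le.mpr ?_) (Submodule.span_le.mpr ?_)
  · rintro _ ⟨i, rfl⟩
    simp [hX, ← hG, mul_comm, h1]
  · rintro _ ⟨i, rfl⟩
    simp [hY, hβ (X _), ← hG, h2]

/-- The pairing matrix of two isotropic subspaces spanning a symplectic space is nonsingular: its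
kernel would provide a vector orthogonal to everything. -/
theorem det_ne_zero_of_isotropic {β : T →ₗ[ℝ] T →ₗ[ℝ] ℝ}
    (hnd : ∀ w, (∀ v, β v w = 0) → w = 0)
    {X Y : Fin n → T} (hY : ∀ i j, β (Y i) (Y j) = 0) (hli : LinearIndependent ℝ Y)
    {G : Matrix (Fin n) (Fin n) ℝ} (hG : ∀ i j, G i j = β (X i) (Y j))
    (htop : Submodule.span ℝ (Set.range X) ⊔ Submodule.span ℝ (Set.range Y) = ⊤) :
    G.det ≠ 0 := by
  intro h0
  obtain ⟨v, hv0, hv⟩ := Matrix.exists_mulVec_eq_zero_iff.mpr h0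
  refine hv0 (funext fun j => Fintype.linearIndependent_iff.mp hli v (hnd _ fun t => ?_) j)
  suffices h : (⊤ : Submodule ℝ T) ≤ LinearMap.ker (β.flip (∑ i, v i • Y i)) from
    h (Submodule.mem_top (x := t))
  rw [← htop]
  refine sup_le (Submodule.span_le.mpr ?_) (Submodule.span_le.mpr ?_)
  · rintro _ ⟨i, rfl⟩
    simpa [Matrix.mulVec, dotProduct, hG, mul_comm] using congrFun hv i
  · rintro _ ⟨i, rfl⟩
    simp [hY]

end LinearAlgebra

section Geometry

variable {N : ℕ} {M : Type*} [TopologicalSpace M]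
  [ChartedSpace (EuclideanSpace ℝ (Fin (2 * N))) M] [IsManifold (𝓡 (2 * N)) ∞ M]
  {Ω : SymplecticForm N M}

/-- The value of a vector field at a point, as a linear map. -/
def VecField.eval (p : M) : VecField N M →ₗ[ℝ] TangentSpace (𝓡 (2 * N)) p where
  toFun X := X p
  map_add' _ _ := rfl
  map_smul' _ _ := rfl

theorem SymplecticForm.antisymm (Ω : SymplecticForm N M) (p : M)
    (v w : TangentSpace (𝓡 (2 * N)) p) : Ω.form p w v = -Ω.form p v w := by
  have h := Ω.alternating p (v + w)
  simp only [map_add, LinearMap.add_apply, Ω.alternating, zero_add, add_zero] at h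
  linarith

theorem SymplecticForm.bilin_apply (Ω : SymplecticForm N M) (X Y : VecField N M) (p : M) :
    Ω.bilin X Y p = Ω.form p (X p) (Y p) := rfl

theorem SymplecticForm.bilin_antisymm (Ω : SymplecticForm N M) (X Y : VecField N M) :
    Ω.bilin Y X = -Ω.bilin X Y := by
  ext p
  exact Ω.antisymm p (X p) (Y p)

/-- Sections which locally become smooth after multiplication by a nonvanishing smooth function
are smooth. -/
theorem VecField.exists_of_smul_eq (s : ∀ p : M, TangentSpace (𝓡 (2 * N)) p)
    (h : ∀ p, ∃ (g : SmoothFun N M) (F : VecField N M), g p ≠ 0 ∧ ∀ q, g q • s q = F q) :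
    ∃ S : VecField N M, ∀ q, S q = s q := by
  refine ⟨⟨s, fun p => ?_⟩, fun q => rfl⟩
  obtain ⟨g, F, hg, hF⟩ := h p
  have h1 : ContMDiffAt (𝓡 (2 * N)) 𝓘(ℝ, ℝ) ∞ (fun q => (g q)⁻¹) p :=
    (g.contMDiff p).inv₀ hg
  refine (h1.smul_section (F.contMDiff p)).congr_of_eventuallyEq ?_
  filter_upwards [g.contMDiff.continuous.continuousAt.eventually_ne hg] with q hq
  have : s q = (g q)⁻¹ • F q := by rw [← hF, inv_smul_smul₀ hq]
  rw [this]
  rfl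

/-- Every tangent vector is the value of a smooth vector field. -/
theorem VecField.exists_eq (D D' : LagrangianDistribution Ω)
    (transversal : ∀ p : M, IsCompl (D.space p) (D'.space p)) (p : M)
    (v : TangentSpace (𝓡 (2 * N)) p) : ∃ X : VecField N M, X p = v := by
  suffices h : (⊤ : Submodule ℝ (TangentSpace (𝓡 (2 * N)) p))
      ≤ LinearMap.range (VecField.eval (N := N) p) from h (Submodule.mem_top (x := v))
  have hle : ∀ D : LagrangianDistribution Ω,
      D.space p ≤ LinearMap.range (VecField.eval (N := N) p) := by
    intro D
    obtain ⟨X, hX⟩ := D.smooth p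
    rw [← hX.self_of_nhds.2, Submodule.span_le]
    rintro _ ⟨i, rfl⟩
    exact ⟨X i, rfl⟩
  rw [← (transversal p).sup_eq_top]
  exact sup_le (hle D) (hle D')

/-- Tangent vectors are separated by their pairings with smooth vector fields. -/
theorem SymplecticForm.eq_of_bilin (D D' : LagrangianDistribution Ω)
    (transversal : ∀ p : M, IsCompl (D.space p) (D'.space p)) {p : M}
    {v w : TangentSpace (𝓡 (2 * N)) p}
    (h : ∀ Z : VecField N M, Ω.form p v (Z p) = Ω.form p w (Z p)) : v = w := by
  refine sub_eq_zero.mp (Ω.nondegenerate p _ fun t => ?_)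
  obtain ⟨Z, rfl⟩ := VecField.exists_eq D D' transversal p t
  rw [map_sub, LinearMap.sub_apply, h, sub_self]

/-- Near every point the module of vector fields has, after multiplication by a smooth function,
a dual basis consisting of fields tangent to one of the two distributions. -/
theorem exists_local_dual_frame [T2Space M] (D D' : LagrangianDistribution Ω)
    (transversal : ∀ p : M, IsCompl (D.space p) (D'.space p)) (p : M) :
    ∃ (g : SmoothFun N M) (e f e' f' : Fin N → VecField N M), g p ≠ 0 ∧
      (∀ i, e i ∈ D.sections) ∧ (∀ i, e' i ∈ D'.sections) ∧
      ∀ Z : VecField N M,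
        g • Z = ∑ i, Ω.bilin Z (f i) • e i + ∑ i, Ω.bilin Z (f' i) • e' i := by
  obtain ⟨X, hX⟩ := D.smooth p
  obtain ⟨Y, hY⟩ := D'.smooth p
  obtain ⟨χ, -, hχ⟩ :=
    (SmoothBumpFunction.nhds_basis_tsupport (I := 𝓡 (2 * N)) p).mem_iff.mp (hX.and hY)
  let χ' : SmoothFun N M := ⟨χ, χ.contMDiff⟩
  have hχ' : ∀ q, χ' q = χ q := fun q => rfl
  let G : Matrix (Fin N) (Fin N) (SmoothFun N M) := Matrix.of fun i j => Ω.bilin (X i) (Y j)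
  -- Determinants and adjugates commute with the evaluation of functions at a point.
  let ev : M → SmoothFun N M →+* ℝ := fun q => ContMDiffMap.evalRingHom q
  have hev : ∀ q (a : SmoothFun N M), ev q a = a q := fun q a => rfl
  have hdet : ∀ q, G.det q = ((ev q).mapMatrix G).det := fun q => by
    rw [← hev, RingHom.map_det]
  have hadj : ∀ q i j, G.adjugate i j q = ((ev q).mapMatrix G).adjugate i j := fun q i j => by
    rw [← RingHom.map_adjugate]; rfl
  have hG : ∀ q i j, (ev q).mapMatrix G i j = Ω.form q (X i q) (Y j q) := fun q i j => rfl
  have hiso : ∀ (D : LagrangianDistribution Ω) (X : Fin N → VecField N M) q,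
      Submodule.span ℝ (Set.range fun i => X i q) = D.space q →
      ∀ i j, Ω.form q (X i q) (X j q) = 0 := fun D X q h i j =>
    D.isotropic q _ (h ▸ Submodule.subset_span ⟨i, rfl⟩) _ (h ▸ Submodule.subset_span ⟨j, rfl⟩)
  have htop : ∀ q, q ∈ tsupport χ → Submodule.span ℝ (Set.range fun i => X i q)
      ⊔ Submodule.span ℝ (Set.range fun i => Y i q) = ⊤ := fun q hq => by
    rw [(hχ hq).1.2, (hχ hq).2.2, (transversal q).sup_eq_top]
  have hp : p ∈ tsupport χ := subset_closure χ.c_mem_support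
  have hzero : ∀ q, q ∉ tsupport χ → χ q = 0 := fun q hq => image_eq_zero_of_notMem_tsupport hq
  have hmem : ∀ (D : LagrangianDistribution Ω) (X : Fin N → VecField N M),
      (∀ q ∈ tsupport χ, Submodule.span ℝ (Set.range fun i => X i q) = D.space q) →
      ∀ i, χ' • X i ∈ D.sections := by
    intro D X h i q
    rw [VecField.fun_smul_apply, hχ']
    by_cases hq : q ∈ tsupport χ
    · exact Submodule.smul_mem _ _ (h q hq ▸ Submodule.subset_span ⟨i, rfl⟩)
    · rw [hzero q hq, zero_smul]; exact Submodule.zero_mem _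
  have hsum : ∀ (X : Fin N → VecField N M) q, (∑ i, X i) q = ∑ i, X i q := fun X q =>
    map_sum (VecField.eval q) X Finset.univ
  have hadd : ∀ (X X' : VecField N M) q, (X + X') q = X q + X' q := fun X X' q => rfl
  have hneg : ∀ (X : VecField N M) q, (-X) q = -X q := fun X q => rfl
  refine ⟨χ' * G.det, fun i => χ' • X i, fun i => ∑ j, G.adjugate j i • Y j,
    fun i => χ' • Y i, fun j => -∑ k, G.adjugate j k • X k, ?_,
    hmem D X fun q hq => (hχ hq).1.2, hmem D' Y fun q hq => (hχ hq).2.2, fun Z => ?_⟩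
  · rw [ContMDiffMap.coe_mul, Pi.mul_apply, hχ', χ.eq_one, one_mul, hdet]
    refine det_ne_zero_of_isotropic (β := Ω.form p) (fun w hw => Ω.nondegenerate p w fun v => ?_)
      (hiso D' Y p (hχ hp).2.2) (hχ hp).2.1 (hG p) (htop p hp)
    rw [Ω.antisymm, hw, neg_zero]
  · ext q : 1
    simp only [VecField.fun_smul_apply, ContMDiffMap.coe_mul, Pi.mul_apply, hadd, hsum,
      Ω.bilin_apply, hneg, hχ']
    by_cases hq : q ∈ tsupport χ
    · have h := det_smul_eq_sum_of_isotropic (β := Ω.form q) (Ω.antisymm q)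
        (hiso D X q (hχ hq).1.2) (hiso D' Y q (hχ hq).2.2) (hG q) (z := Z q)
        (htop q hq ▸ Submodule.mem_top)
      rw [mul_smul, hdet, h, smul_add, Finset.smul_sum, Finset.smul_sum]
      simp only [hadj, smul_comm (χ q)]
    · simp [hzero q hq]

/-- The pointwise projections along `D'` onto `D` preserve smoothness, and thus define a projection
from the vector fields to those tangent to `D`, along those tangent to `D'`. -/
theorem exists_sections_projection [T2Space M] (D D' : LagrangianDistribution Ω)
    (transversal : ∀ p : M, IsCompl (D.space p) (D'.space p)) :
    ∃ P : VecField N M →ₗ[SmoothFun N M] VecField N M, (∀ Z, P Z ∈ D.sections) ∧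
      (∀ Z, Z - P Z ∈ D'.sections) ∧ (∀ Z ∈ D.sections, P Z = Z) ∧
      ∀ Z ∈ D'.sections, P Z = 0 := by
  have key : ∀ Z : VecField N M, ∃ S : VecField N M, ∀ q,
      S q = (D.space q).projection (D'.space q) (transversal q) (Z q) := by
    intro Z
    refine VecField.exists_of_smul_eq _ fun p => ?_
    obtain ⟨g, e, f, e', f', hg, he, he', h⟩ := exists_local_dual_frame D D' transversal p
    refine ⟨g, ∑ i, Ω.bilin Z (f i) • e i, hg, fun q => ?_⟩
    have h1 : (∑ i, Ω.bilin Z (f i) • e i) ∈ D.sections :=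
      Submodule.sum_mem _ fun i _ => Submodule.smul_mem _ _ (he i)
    have h2 : (∑ i, Ω.bilin Z (f' i) • e' i) ∈ D'.sections :=
      Submodule.sum_mem _ fun i _ => Submodule.smul_mem _ _ (he' i)
    have h3 := congrArg (fun X : VecField N M => X q) (h Z)
    simp only [VecField.fun_smul_apply] at h3
    rw [← map_smul, h3]
    change Submodule.projection _ _ _ ((∑ i, Ω.bilin Z (f i) • e i : VecField N M) q
      + (∑ i, Ω.bilin Z (f' i) • e' i : VecField N M) q) = _
    rw [map_add, Submodule.projection_apply_of_mem_left _ (h1 q),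
      Submodule.projection_apply_of_mem_right _ (h2 q), add_zero]
  choose S hS using key
  refine ⟨{ toFun := S, map_add' := fun Z Z' => ?_, map_smul' := fun a Z => ?_ },
    fun Z q => ?_, fun Z q => ?_, fun Z hZ => ?_, fun Z hZ => ?_⟩
  · ext q : 1
    change S (Z + Z') q = S Z q + S Z' q
    rw [hS, hS, hS, ← map_add]
    rfl
  · ext q : 1
    rw [RingHom.id_apply, VecField.fun_smul_apply, hS, hS, ← map_smul]
    rfl
  · change S Z q ∈ _
    rw [hS]
    exact Submodule.projection_apply_mem _ _
  · change Z q - S Z q ∈ _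
    rw [hS, ← Submodule.projection_eq_self_sub_projection]
    exact Submodule.projection_apply_mem _ _
  · ext q : 1
    exact (hS Z q).trans (Submodule.projection_apply_of_mem_left _ (hZ q))
  · ext q : 1
    exact (hS Z q).trans (Submodule.projection_apply_of_mem_right _ (hZ q))

/-- The symplectic form identifies the vector fields with the linear forms on vector fields. -/
theorem SymplecticForm.flat_bijective [T2Space M] (D D' : LagrangianDistribution Ω)
    (transversal : ∀ p : M, IsCompl (D.space p) (D'.space p)) :
    Function.Bijective Ω.flat := by
  constructor
  · intro X X' h
    ext p : 1
    refine SymplecticForm.eq_of_bilin D D' transversal fun Z => ?_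
    exact congrArg (fun φ : Module.Dual (SmoothFun N M) (VecField N M) => φ Z p) h
  · intro φ
    -- The linear form is locally represented by a vector field, divided by a function.
    have key : ∀ p, ∃ (g : SmoothFun N M) (F : VecField N M), g p ≠ 0 ∧
        ∀ Z, g * φ Z = Ω.bilin F Z := by
      intro p
      obtain ⟨g, e, f, e', f', hg, -, -, h⟩ := exists_local_dual_frame D D' transversal p
      refine ⟨g, -(∑ i, φ (e i) • f i + ∑ i, φ (e' i) • f' i), hg, fun Z => ?_⟩
      have h1 := congrArg φ (h Z)
      rw [map_smul, smul_eq_mul] at h1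
      rw [h1, Ω.bilin_antisymm Z, map_neg, neg_neg, map_add, map_add, map_sum, map_sum, map_sum,
        map_sum]
      simp only [map_smul, smul_eq_mul]
      congr 1 <;> exact Finset.sum_congr rfl fun i _ => mul_comm _ _
    choose g F hg hF using key
    have heq : ∀ p q (Z : VecField N M), g p q * φ Z q = Ω.form q (F p q) (Z q) :=
      fun p q Z => congrArg (fun a : SmoothFun N M => a q) (hF p Z)
    obtain ⟨S, hS⟩ := VecField.exists_of_smul_eq (N := N) (fun q => (g q q)⁻¹ • F q q)
      fun p => ⟨g p, F p, hg p, fun q => by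
        refine SymplecticForm.eq_of_bilin D D' transversal fun Z => ?_
        rw [← heq, map_smul, map_smul, LinearMap.smul_apply, LinearMap.smul_apply, ← heq,
          smul_eq_mul, smul_eq_mul, inv_mul_cancel_left₀ (hg q)]⟩
    refine ⟨S, LinearMap.ext fun Z => ?_⟩
    ext q
    change Ω.form q (S q) (Z q) = φ Z q
    rw [hS, map_smul, LinearMap.smul_apply, ← heq, smul_eq_mul, inv_mul_cancel_left₀ (hg q)]

theorem LagrangianDistribution.bilin_sections (D : LagrangianDistribution Ω) :
    ∀ X ∈ D.sections, ∀ Y ∈ D.sections, Ω.bilin X Y = 0 := by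
  intro X hX Y hY
  ext q
  exact D.isotropic q _ (hX q) _ (hY q)

end Geometry

/-! ### Extension of scalars -/

section BaseChange

variable {A E : Type*} [CommRing A] [AddCommGroup E] [Module A E] (B : Type*) [CommRing B]
  [Algebra A B]

theorem LinearMap.BilinForm.baseChange_antisymm {β : LinearMap.BilinForm A E}
    (h : ∀ x y, β y x = -β x y) (x y : B ⊗[A] E) :
    LinearMap.BilinForm.baseChange B β y x = -LinearMap.BilinForm.baseChange B β x y := by
  induction x using TensorProduct.induction_on with
  | zero => simp
  | add x x' hx hx' => rw [map_add, map_add, LinearMap.add_apply, hx, hx', neg_add]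
  | tmul b x =>
    induction y using TensorProduct.induction_on with
    | zero => simp
    | add y y' hy hy' => rw [map_add, map_add, LinearMap.add_apply, hy, hy', neg_add]
    | tmul c y => simp [h x y, mul_comm]

theorem LinearMap.BilinForm.baseChange_isotropic {β : LinearMap.BilinForm A E}
    {L : Submodule A E} (h : ∀ x ∈ L, ∀ y ∈ L, β x y = 0) :
    ∀ x ∈ L.baseChange B, ∀ y ∈ L.baseChange B, LinearMap.BilinForm.baseChange B β x y = 0 := by
  rintro _ ⟨x, rfl⟩ _ ⟨y, rfl⟩
  induction x using TensorProduct.induction_on with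
  | zero => simp
  | add x x' hx hx' => rw [map_add, map_add, LinearMap.add_apply, hx, hx', add_zero]
  | tmul b x =>
    induction y using TensorProduct.induction_on with
    | zero => simp
    | add y y' hy hy' => rw [map_add, map_add, hy, hy', add_zero]
    | tmul c y => simp [h x x.2 y y.2]

theorem LinearMap.baseChange_apply_mem {f : E →ₗ[A] E} {L : Submodule A E} (h : ∀ x, f x ∈ L)
    (x : B ⊗[A] E) : f.baseChange B x ∈ L.baseChange B := by
  induction x using TensorProduct.induction_on with
  | zero => simp
  | add x x' hx hx' => rw [map_add]; exact Submodule.add_mem _ hx hx'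
  | tmul b x => exact Submodule.tmul_mem_baseChange_of_mem b (h x)

theorem LinearMap.baseChange_congr_of_mem {f g : E →ₗ[A] E} {L : Submodule A E}
    (h : ∀ x ∈ L, f x = g x) : ∀ x ∈ L.baseChange B, f.baseChange B x = g.baseChange B x := by
  rintro _ ⟨x, rfl⟩
  induction x using TensorProduct.induction_on with
  | zero => simp
  | add x x' hx hx' => rw [map_add, map_add, map_add, hx, hx']
  | tmul b x => simp [h x x.2]

/-- The assertions about the Koszul complexes hold after extension of scalars, if the module
decomposes into isotropic submodules before it. The decomposition is given by a projection. -/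
theorem exists_koszulTransport_baseChange (ρ : ℝ →+* B) {β : LinearMap.BilinForm A E} (l : B)
    {L L' : Submodule A E} (hβ : ∀ x y, β y x = -β x y)
    (hL : ∀ x ∈ L, ∀ y ∈ L, β x y = 0) (hL' : ∀ x ∈ L', ∀ y ∈ L', β x y = 0)
    (hp : ∃ p : E →ₗ[A] E, (∀ x, p x ∈ L) ∧ (∀ x, x - p x ∈ L') ∧ (∀ x ∈ L, p x = x) ∧
      ∀ x ∈ L', p x = 0) {F : Type*} [AddCommGroup F] [Module A F]
    {u : E →ₗ[A] F} (hu : Function.Bijective u) :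
    ∃ δS δW π e h, KoszulTransport ρ (LinearMap.BilinForm.baseChange B β) l (u.baseChange B)
      (L.baseChange B) (L'.baseChange B) δS δW π e h := by
  obtain ⟨p, hp, hp', hpL, hpL'⟩ := hp
  obtain ⟨δS, δW, π, h, H⟩ := exists_koszulTransport ρ (LinearMap.BilinForm.baseChange B β) l
    (L.baseChange B) (L'.baseChange B) (LinearMap.BilinForm.baseChange_antisymm B hβ)
    (LinearMap.BilinForm.baseChange_isotropic B hL)
    (LinearMap.BilinForm.baseChange_isotropic B hL') (p := p.baseChange B)
    (LinearMap.baseChange_apply_mem B hp)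
    (fun x => by
      have := LinearMap.baseChange_apply_mem B (f := LinearMap.id - p) hp' x
      rwa [LinearMap.baseChange_sub, LinearMap.baseChange_id] at this)
    (fun x hx => by
      have := LinearMap.baseChange_congr_of_mem B (f := p) (g := LinearMap.id) hpL x hx
      rwa [LinearMap.baseChange_id] at this)
    (fun x hx => by
      have := LinearMap.baseChange_congr_of_mem B (f := p) (g := 0) hpL' x hx
      rwa [LinearMap.baseChange_zero] at this)
    ((LinearEquiv.ofBijective u hu).baseChange A B E F)
  exact ⟨δS, δW, π, _, h, H⟩

end BaseChange

end

/-- `A = C^∞(M)`, `E = Γ(TM)`, and `B` stands for `A[l]` or `A[[l]]` (or any other commutative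
`A`-algebra with a distinguished element `l`); every module is extended from `A` to `B`. -/
theorem mainTheorem3 {N : ℕ} {M : Type*} [TopologicalSpace M] [T2Space M]
    [SecondCountableTopology M] [ChartedSpace (EuclideanSpace ℝ (Fin (2 * N))) M]
    [IsManifold (𝓡 (2 * N)) ∞ M]
    (Ω : SymplecticForm N M) (D : Polarization Ω) (D' : LagrangianDistribution Ω)
    (transversal : ∀ p : M, IsCompl (D.space p) (D'.space p))
    (B : Type*) [CommRing B] [Algebra (SmoothFun N M) B] (l : B) :
    ∃ δS δW π e h, KoszulTransport
      ((algebraMap (SmoothFun N M) B).comp (algebraMap ℝ (SmoothFun N M)))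
      (LinearMap.BilinForm.baseChange B Ω.bilin) l (Ω.flat.baseChange B)
      (D.sections.baseChange B) (D'.sections.baseChange B) δS δW π e h := by
  exact exists_koszulTransport_baseChange B _ l Ω.bilin_antisymm D.bilin_sections
    D'.bilin_sections (exists_sections_projection D.toLagrangianDistribution D' transversal)
    (Ω.flat_bijective D.toLagrangianDistribution D' transversal)
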